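/- All C*-algebras are unital and inclusions of C*-algebras are unital. An operator system in a C*-algebra $B$ is a linear subspace $S\subseteq B$ with $1\in S$ and $S^*=S$. It is regarded as a many-sorted metric structure with sorts $M_n(S)$ (with the operator norm), the positive cones $\mathcal C_n(S)\subseteq M_n(S)$, the scalar matrices $M_{m,n}(\mathbb C)$ (with the operator norm) and $\mathbb R^{\ge 0}$. The symbols are: the constants $0,1\in S$; addition, adjoint and multiplication by complex scalars on $M_n(S)$; addition and multiplication by nonnegative reals on $\mathcal C_n(S)$; the maps $(A,X)\mapsto A^*XA$ for $A\in M_{m,n}(\mathbb C)$ and $X\in M_m(S)$ or $X\in \mathcal C_m(S)$; the inclusions $\mathcal C_n(S)\to M_n(S)$; the maps $X\mapsto \begin{pmatrix} I & X\\ X^* & I\end{pmatrix}$ from $M_n(S)$ to $M_{2n}(S)$; the matrix entries; the addition, multiplication and adjoint of scalar matrices and the constants $1,i\in\mathbb C$; the norms on $M_n(S)$; and the metric of each sort. Quantifier-free formulas are built from the atomic formulas (norms and distances of terms) by continuous connectives $\mathbb R^k\to\mathbb R$, and an existential formula is $\inf_y\varphi(x,y)$ with $\varphi$ quantifier-free and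 each variable $y_j$ ranging over the elements of norm at most $N_j$ of its sort, $N_j\ge 1$ an integer. For $S\subseteq T$, the operator system $S$ is existentially closed (e.c.) in $T$ as an operator system if each existential formula has the same value in $S$ and in $T$ at all tuples of parameters from $S$. (1) Let $H$ be a complex Hilbert space and $X\subseteq B(H)$ an operator system which is e.c. in $B(H)$ as an operator system. Then $X$ is weakly injective: there is a unital completely positive map $\phi:B(H)\to\overline X$ with $\phi|_X=\mathrm{id}_X$, where $\overline X$ is the closure of $X$ in the weak operator topology. (2) Let $A$ be a unital C*-algebra which is semi-existentially closed as an operator system, i.e. $A$ is e.c. in $B$ as an operator system for each unital inclusion $A\subseteq B$ of C*-algebras. Then $A$ has Lance's weak expectation property: for each unital inclusion $A\subseteq B$ of C*-algebras there is a linear contraction $\phi:B\to A^{**}$ whose restriction to $A$ is the canonical embedding $A\to A^{**}$. (3) In particular, let $A$ be an e.c. unital C*-algebra, i.e. for each unital inclusion $A\subseteq B$ of C*-algebras, each quantifier-free formula $\varphi(x,y)$ in the language of unital C*-algebras (continuous connectives applied to norms and distances of $*$-polynomials), each integer $n\ge1$ and each tuple $a$ from $A$, one has $\inf\{\varphi(a,b):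 b\in A,\ \|b_j\|\le n\}=\inf\{\varphi(a,c): c\in B,\ \|c_j\|\le n\}$. Then $A$ is semi-existentially closed as an operator system, and hence has the weak expectation property. -/

import Mathlib

open scoped ComplexOrder CStarAlgebra NNReal

universe u v

noncomputable section

/-! ### Concrete operator systems -/

/-- A (concrete) operator system in a unital C⋆-algebra `B`: a linear subspace of `B` that contains
the unit and is closed under the adjoint. -/
structure OperatorSystem (B : Type u) [CStarAlgebra B] extends Submodule ℂ B where
  one_mem' : (1 : B) ∈ carrier
  star_mem' : ∀ {x : B}, x ∈ carrier → star x ∈ carrier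

namespace OperatorSystem

instance (B : Type u) [CStarAlgebra B] : SetLike (OperatorSystem B) B where
  coe X := X.carrier
  coe_injective := by
    rintro ⟨X, _, _⟩ ⟨Y, _, _⟩ h
    obtain rfl : X = Y := SetLike.coe_injective h
    rfl

/-- A unital C⋆-algebra, seen as an operator system in itself. -/
def whole (B : Type u) [CStarAlgebra B] : OperatorSystem B where
  toSubmodule := ⊤
  one_mem' := trivial
  star_mem' := fun _ => trivial

end OperatorSystem

/-! ### The language of operator systems in continuous logic -/

/-- The sorts of the language of operator systems: `mat n` for `M_n(S)`, `cone n` for the positive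
cone of `M_n(S)`, `scal m n` for `M_{m,n}(ℂ)`, and `nonneg` for the nonnegative reals. In particular
`mat 1` is the sort of `S` itself, and `scal 1 1` that of `ℂ`. (The sorts with `n = 0` have just one
element.) -/
inductive OpSysSort : Type
  | mat (n : ℕ)
  | cone (n : ℕ)
  | scal (m n : ℕ)
  | nonneg

open OpSysSort

/-- Terms of sort `s` of the language of operator systems, with variables indexed by `I`, the
variable `i` having sort `σ i`. -/
inductive OpSysTerm {I : Type} (σ : I → OpSysSort) : OpSysSort → Type
  | var (i : I) : OpSysTerm σ (σ i)
  /-- the constants `0, 1 ∈ S` -/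
  | zero : OpSysTerm σ (mat 1)
  | one : OpSysTerm σ (mat 1)
  /-- the `⋆`-vector space operations of `M_n(S)` -/
  | add {n : ℕ} (x y : OpSysTerm σ (mat n)) : OpSysTerm σ (mat n)
  | adj {n : ℕ} (x : OpSysTerm σ (mat n)) : OpSysTerm σ (mat n)
  | smul {n : ℕ} (c : OpSysTerm σ (scal 1 1)) (x : OpSysTerm σ (mat n)) : OpSysTerm σ (mat n)
  /-- `(A, X) ↦ A⋆XA`, for `A ∈ M_{m,n}(ℂ)` and `X ∈ M_m(S)` -/
  | conj {m n : ℕ} (A : OpSysTerm σ (scal m n)) (x : OpSysTerm σ (mat m)) : OpSysTerm σ (mat n)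
  /-- addition, multiplication by nonnegative reals, and `(A, X) ↦ A⋆XA` on the cones -/
  | coneAdd {n : ℕ} (x y : OpSysTerm σ (cone n)) : OpSysTerm σ (cone n)
  | coneSmul {n : ℕ} (r : OpSysTerm σ nonneg) (x : OpSysTerm σ (cone n)) : OpSysTerm σ (cone n)
  | coneConj {m n : ℕ} (A : OpSysTerm σ (scal m n)) (x : OpSysTerm σ (cone m)) :
      OpSysTerm σ (cone n)
  /-- the inclusion of the cone of `M_n(S)` in `M_n(S)` -/
  | incl {n : ℕ} (x : OpSysTerm σ (cone n)) : OpSysTerm σ (mat n)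
  /-- `X ↦ [[I, X], [X⋆, I]]` -/
  | block {n : ℕ} (x : OpSysTerm σ (mat n)) : OpSysTerm σ (mat (n + n))
  /-- matrix entries -/
  | entry {n : ℕ} (i j : Fin n) (x : OpSysTerm σ (mat n)) : OpSysTerm σ (mat 1)
  | scalEntry {m n : ℕ} (i : Fin m) (j : Fin n) (A : OpSysTerm σ (scal m n)) :
      OpSysTerm σ (scal 1 1)
  /-- addition, multiplication and adjoint of scalar matrices, and the constants `1, i ∈ ℂ` -/
  | scalAdd {m n : ℕ} (A C : OpSysTerm σ (scal m n)) : OpSysTerm σ (scal m n)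
  | scalMul {l m n : ℕ} (A : OpSysTerm σ (scal l m)) (C : OpSysTerm σ (scal m n)) :
      OpSysTerm σ (scal l n)
  | scalAdj {m n : ℕ} (A : OpSysTerm σ (scal m n)) : OpSysTerm σ (scal n m)
  | scalOne : OpSysTerm σ (scal 1 1)
  | scalI : OpSysTerm σ (scal 1 1)

/-- Quantifier-free formulas of the language of operator systems: the atomic formulas are the norm
on the sorts `M_n(S)` and the metric on every sort, and the connectives are all continuous functions
`ℝᵏ → ℝ`. -/
inductive OpSysQF {I : Type} (σ : I → OpSysSort) : Type
  | norm {n : ℕ} (x : OpSysTerm σ (mat n)) : OpSysQF σ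
  | dist {s : OpSysSort} (x y : OpSysTerm σ s) : OpSysQF σ
  | conn {k : ℕ} (c : (Fin k → ℝ) → ℝ) (hc : Continuous c) (φ : Fin k → OpSysQF σ) : OpSysQF σ

/-! ### Interpretation

An operator system `S` in `B` is interpreted inside the matrix algebras over `B`: the elements of the
structure are the values that lie in `OpSysSort.Dom S s`, and the symbols are interpreted by the
operations of the matrix algebras over `B`, under which these sets are closed. -/

namespace OpSysSort

/-- The ambient space of the elements of sort `s`, for operator systems in `B`. -/
abbrev Val (B : Type u) : OpSysSort → Type u
  | mat n => CStarMatrix (Fin n) (Fin n) B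
  | cone n => CStarMatrix (Fin n) (Fin n) B
  | scal m n => ULift.{u} (CStarMatrix (Fin m) (Fin n) ℂ)
  | nonneg => ULift.{u} ℝ≥0

/-- Transport along a map `f : A → B`: `f` is applied to each entry of a matrix over `A`; scalars
stay the same. -/
def Val.map {A B : Type u} (f : A → B) : (s : OpSysSort) → s.Val A → s.Val B
  | mat _, x => CStarMatrix.map x f
  | cone _, x => CStarMatrix.map x f
  | scal _ _, x => x
  | nonneg, x => x

variable {B : Type u} [CStarAlgebra B] [PartialOrder B] [StarOrderedRing B]

/-- The elements of sort `s` of the operator system `S`: matrices with entries in `S`; those which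
moreover are positive; all scalar matrices; all nonnegative reals. -/
def Dom (S : OperatorSystem B) : (s : OpSysSort) → Set (s.Val B)
  | mat n => {x : CStarMatrix (Fin n) (Fin n) B | ∀ i j, x i j ∈ S}
  | cone n => {x : CStarMatrix (Fin n) (Fin n) B | 0 ≤ x ∧ ∀ i j, x i j ∈ S}
  | scal _ _ => Set.univ
  | nonneg => Set.univ

/-- The metric of each sort, given by the operator norm on matrices and the absolute value on
nonnegative reals. -/
def Val.dist : (s : OpSysSort) → s.Val B → s.Val B → ℝ
  | mat _, x, y => ‖x - y‖
  | cone _, x, y => ‖x - y‖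
  | scal _ _, x, y => ‖x.down - y.down‖
  | nonneg, x, y => |(x.down : ℝ) - y.down|

/-- The size of an element; the domains of quantification of the sort `s` are `size ≤ N` for
`N ≥ 1`. -/
def Val.size : (s : OpSysSort) → s.Val B → ℝ
  | mat _, x => ‖x‖
  | cone _, x => ‖x‖
  | scal _ _, x => ‖x.down‖
  | nonneg, x => (x.down : ℝ)

end OpSysSort

section Operations

variable {B : Type u} [CStarAlgebra B]

/-- `A⋆XA` for a scalar matrix `A` and a matrix `X` over `B`. -/
def scalarConj {m n : ℕ} (A : CStarMatrix (Fin m) (Fin n) ℂ) (X : CStarMatrix (Fin m) (Fin m) B) :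
    CStarMatrix (Fin n) (Fin n) B :=
  CStarMatrix.ofMatrix fun i j => ∑ k, ∑ l, (star (A k i) * A l j) • X k l

/-- The matrix `[[I, X], [X⋆, I]]`. -/
def selfAdjointBlock {n : ℕ} (X : CStarMatrix (Fin n) (Fin n) B) :
    CStarMatrix (Fin (n + n)) (Fin (n + n)) B :=
  CStarMatrix.ofMatrix
    (Matrix.reindex finSumFinEquiv finSumFinEquiv
      (Matrix.fromBlocks 1 (CStarMatrix.ofMatrix.symm X) (CStarMatrix.ofMatrix.symm (star X)) 1))

end Operations

/-- The `1 × 1` matrix with the given entry. -/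
def oneByOne {R : Type u} (x : R) : CStarMatrix (Fin 1) (Fin 1) R :=
  CStarMatrix.ofMatrix fun _ _ => x

section Evaluation

variable {B : Type u} [CStarAlgebra B] [PartialOrder B] [StarOrderedRing B]
  {I : Type} {σ : I → OpSysSort}

/-- The value of a term at an assignment of its variables. -/
def OpSysTerm.eval (a : ∀ i, (σ i).Val B) : {s : OpSysSort} → OpSysTerm σ s → s.Val B
  | _, .var i => a i
  | _, .zero => oneByOne (0 : B)
  | _, .one => oneByOne (1 : B)
  | _, .add x y => x.eval a + y.eval a
  | _, .adj x => star x.eval a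
  | _, .smul c x => (c.eval a).down 0 0 • x.eval a
  | _, .conj A x => scalarConj (A.eval a).down (x.eval a)
  | _, .coneAdd x y => x.eval a + y.eval a
  | _, .coneSmul r x =>
      (((r.eval a).down : ℝ) : ℂ) • x.eval a
  | _, .coneConj A x => scalarConj (A.eval a).down (x.eval a)
  | _, .incl x => x.eval a
  | _, .block x => selfAdjointBlock (x.eval a)
  | _, .entry i j x => oneByOne (x.eval a i j)
  | _, .scalEntry i j A => ⟨oneByOne ((A.eval a).down i j)⟩
  | _, .scalAdd A C => ⟨(A.eval a).down + (C.eval a).down⟩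
  | _, .scalMul A C => ⟨(A.eval a).down * (C.eval a).down⟩
  | _, .scalAdj A => ⟨(A.eval a).down.conjTranspose⟩
  | _, .scalOne => ⟨oneByOne 1⟩
  | _, .scalI => ⟨oneByOne Complex.I⟩

/-- The value of a quantifier-free formula at an assignment of its variables. -/
def OpSysQF.eval (a : ∀ i, (σ i).Val B) : OpSysQF σ → ℝ
  | .norm x => Val.size _ (x.eval a)
  | .dist x y => Val.dist _ (x.eval a) (y.eval a)
  | .conn c _ φ => c fun i => (φ i).eval a

end Evaluation

section Existential

variable {B : Type u} [CStarAlgebra B] [PartialOrder B] [StarOrderedRing B]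
  {p q : ℕ} {Γ : Fin p → OpSysSort} {Δ : Fin q → OpSysSort}

/-- The value in the operator system `S`, at the parameters `a`, of the existential formula
`inf_y φ(x, y)`, where the variable `y j` ranges over the domain of quantification of radius
`N j` of its sort. -/
def OpSysQF.existsValue (φ : OpSysQF (Sum.elim Γ Δ)) (N : Fin q → ℕ) (S : OperatorSystem B)
    (a : ∀ i, (Γ i).Val B) : ℝ :=
  sInf {r : ℝ | ∃ b : ∀ j, (Δ j).Val B,
    (∀ j, b j ∈ Dom S (Δ j) ∧ Val.size (Δ j) (b j) ≤ N j) ∧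
    r = φ.eval (fun | .inl i => a i | .inr j => b j)}

end Existential

namespace OperatorSystem

/-- Let `f : A → B` be the injective unital ⋆-homomorphism through which the operator system `S` in
`A` is seen inside the operator system `T` in `B`. Then `S` is existentially closed in `T`, in the
language of operator systems, if each existential formula takes the same value in `S` and in `T`,
for all parameters from `S`. -/
def IsExistentialEmbedding {A B : Type u} [CStarAlgebra A] [PartialOrder A] [StarOrderedRing A]
    [CStarAlgebra B] [PartialOrder B] [StarOrderedRing B]
    (f : A →⋆ₐ[ℂ] B) (S : OperatorSystem A) (T : OperatorSystem B) : Prop :=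
  Function.Injective f ∧ (∀ x ∈ S, f x ∈ T) ∧
  ∀ (p q : ℕ) (Γ : Fin p → OpSysSort) (Δ : Fin q → OpSysSort) (φ : OpSysQF (Sum.elim Γ Δ))
    (N : Fin q → ℕ), (∀ j, 1 ≤ N j) →
    ∀ a : ∀ i, (Γ i).Val A, (∀ i, a i ∈ Dom S (Γ i)) →
      φ.existsValue N S a = φ.existsValue N T (fun i => Val.map f (Γ i) (a i))

/-- `S ⊆ T` is existentially closed in `T`, for operator systems `S` and `T` in the same algebra. -/
def IsExistentiallyClosedIn {B : Type u} [CStarAlgebra B] [PartialOrder B] [StarOrderedRing B]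
    (S T : OperatorSystem B) : Prop :=
  IsExistentialEmbedding (StarAlgHom.id ℂ B) S T

/-- An operator system `X` in `B(H)` is weakly injective if there is a unital completely positive map
from `B(H)` to the closure of `X` in the weak operator topology which extends the identity of `X`. -/
def IsWeaklyInjective {H : Type u} [NormedAddCommGroup H] [InnerProductSpace ℂ H] [CompleteSpace H]
    (X : OperatorSystem (H →L[ℂ] H)) : Prop :=
  ∃ φ : (H →L[ℂ] H) →CP (H →L[ℂ] H),
    φ 1 = 1 ∧
    (∀ T, ContinuousLinearMapWOT.ofCLM (φ T) ∈
      closure (ContinuousLinearMapWOT.ofCLM '' (X : Set (H →L[ℂ] H)))) ∧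
    ∀ T ∈ X, φ T = T

end OperatorSystem

/-- A unital C⋆-algebra `A` is semi-existentially closed as an operator system if, for each unital
inclusion `A ⊆ B` of C⋆-algebras, `A` is existentially closed in `B` in the language of operator
systems. -/
def IsSemiExistentiallyClosed (A : Type u) [CStarAlgebra A] [PartialOrder A] [StarOrderedRing A] :
    Prop :=
  ∀ (B : Type u) [CStarAlgebra B] [PartialOrder B] [StarOrderedRing B] (ι : A →⋆ₐ[ℂ] B),
    Function.Injective ι →
      OperatorSystem.IsExistentialEmbedding ι (OperatorSystem.whole A) (OperatorSystem.whole B)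

/-! ### The language of unital C⋆-algebras -/

/-- Terms of the language of unital C⋆-algebras: `⋆`-polynomials in the variables. -/
inductive CStarTerm (V : Type) : Type
  | var (i : V) : CStarTerm V
  | zero : CStarTerm V
  | one : CStarTerm V
  | smul (c : ℂ) (s : CStarTerm V) : CStarTerm V
  | add (s t : CStarTerm V) : CStarTerm V
  | mul (s t : CStarTerm V) : CStarTerm V
  | adj (s : CStarTerm V) : CStarTerm V

/-- Quantifier-free formulas of the language of unital C⋆-algebras. -/
inductive CStarQF (V : Type) : Type
  | norm (s : CStarTerm V) : CStarQF V
  | dist (s t : CStarTerm V) : CStarQF V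
  | conn {k : ℕ} (c : (Fin k → ℝ) → ℝ) (hc : Continuous c) (φ : Fin k → CStarQF V) : CStarQF V

section CStarEvaluation

variable {A : Type u} [CStarAlgebra A]

/-- The value of a term at an assignment of its variables. -/
def CStarTerm.eval {V : Type} (a : V → A) : CStarTerm V → A
  | .var i => a i
  | .zero => 0
  | .one => 1
  | .smul c s => c • s.eval a
  | .add s t => s.eval a + t.eval a
  | .mul s t => s.eval a * t.eval a
  | .adj s => star (s.eval a)

/-- The value of a quantifier-free formula at an assignment of its variables. -/
def CStarQF.eval {V : Type} (a : V → A) : CStarQF V → ℝ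
  | .norm s => ‖s.eval a‖
  | .dist s t => ‖s.eval a - t.eval a‖
  | .conn c _ φ => c fun i => (φ i).eval a

/-- `inf {φ(a, b) : b ∈ A, ‖b‖ ≤ N}`. -/
def CStarQF.existsValue {p q : ℕ} (φ : CStarQF (Fin p ⊕ Fin q)) (N : ℕ) (a : Fin p → A) : ℝ :=
  sInf {r : ℝ | ∃ b : Fin q → A, (∀ j, ‖b j‖ ≤ N) ∧ r = φ.eval (Sum.elim a b)}

end CStarEvaluation

/-- A unital C⋆-algebra `A` is existentially closed if each existential formula of the language of
unital C⋆-algebras takes the same value in `A` and in `B`, for all parameters from `A` and all unital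
inclusions `A ⊆ B` of C⋆-algebras. -/
def IsExistentiallyClosedCStarAlgebra (A : Type u) [CStarAlgebra A] : Prop :=
  ∀ (B : Type u) [CStarAlgebra B] (ι : A →⋆ₐ[ℂ] B), Function.Injective ι →
    ∀ (p q : ℕ) (φ : CStarQF (Fin p ⊕ Fin q)) (N : ℕ), 1 ≤ N →
      ∀ a : Fin p → A, φ.existsValue N a = φ.existsValue N (fun i => ι (a i))

/-! ### The weak expectation property -/

/-- For a unital inclusion `ι : A → B` of C⋆-algebras: `B` is weakly injective relative to `A` if
there is a linear contraction `B → A⋆⋆` which restricts to the canonical embedding of `A` in its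
Banach space bidual `A⋆⋆`. -/
def IsWeaklyInjectiveRelativeTo {A B : Type u} [CStarAlgebra A] [CStarAlgebra B]
    (ι : A →⋆ₐ[ℂ] B) : Prop :=
  ∃ φ : B →ₗ[ℂ] StrongDual ℂ (StrongDual ℂ A),
    (∀ b : B, ‖φ b‖ ≤ ‖b‖) ∧ ∀ a : A, φ (ι a) = NormedSpace.inclusionInDoubleDual ℂ A a

/-- Lance's weak expectation property of a unital C⋆-algebra `A`: each unital extension `A ⊆ B` is
weakly injective relative to `A`. -/
def HasWeakExpectationProperty (A : Type u) [CStarAlgebra A] : Prop :=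
  ∀ (B : Type u) [CStarAlgebra B] (ι : A →⋆ₐ[ℂ] B), Function.Injective ι →
    IsWeaklyInjectiveRelativeTo ι

end

/-!
Existential closedness is used through approximations. Elements of `B` which witness the value of
an existential formula are approximated by elements of the smaller structure; a family of such
approximations indexed by the finite sets of conditions is a net, and maps are obtained as limits.

*From existential closedness to maps.* If the operator system `S ⊆ A` is existentially closed in
`B`, the conditions "`b ↦ y b` is linear, isometric and the identity on `S`" and "`[y (T j k)]` is
a positive matrix for each positive `T`" hold in `B` for `y b = b`. With a variable in a cone for
each `T`, each of them says that a nonnegative quantifier-free formula vanishes. Hence finitely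
many of them hold in `S` up to any `ε > 0`
(`OperatorSystem.IsExistentialEmbedding.exists_approx_maps`). Along an ultrafilter the maps `y`
converge weak-⋆ to a linear contraction `B → A⋆⋆` extending the embedding of `S`
(`OperatorSystem.IsExistentialEmbedding.exists_limit`). For `S = A` this is the weak expectation
property. For `A = B = B(H)`, evaluating the limit at the vector functionals `T ↦ ⟪x, T y⟫` gives a
map `φ` into operators on `H` which is a pointwise limit of the maps `y` in the weak operator
topology. It is completely positive, as a matrix of operators is positive if and only if its
quadratic form on `Hⁿ` is (`CStarMatrix.nonneg_of_inner_toEnd_nonneg`).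

*From C⋆-algebras to operator systems.* Existential closedness of a C⋆-algebra `A` approximates
elements of `B ⊇ A` by elements of `A`, in such a way that the norm of each `⋆`-polynomial
converges. Matrix norms are not part of the language of C⋆-algebras, but they are determined by
norms of `⋆`-polynomials: for a matrix `X` of `⋆`-polynomials,
`‖X‖ ^ (2 * 2 ^ k) = ‖(X⋆X) ^ 2 ^ k‖` is comparable, up to a factor independent of `k`, to the sum of the norms of the entries of
`(X⋆X) ^ 2 ^ k`, so that `‖X‖` converges as well (`CStarMatrix.tendsto_norm_of_entries`). Terms of
the language of operator systems are matrices of `⋆`-polynomials, once elements of the cones are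
written as `Z⋆Z` and scalars are kept fixed. So all quantifier-free formulas converge
(`OpSysQF.tendsto_eval`). To stay within the domains of quantification, the witnesses in `B` are
first scaled by a factor `r < 1` close to `1`.
-/

open OpSysSort Filter Topology

/-! ### Norms of matrices over a C⋆-algebra -/

namespace CStarMatrix

theorem norm_le_sum_norm_entry {A : Type*} [CStarAlgebra A] [PartialOrder A] [StarOrderedRing A]
    {m n : Type*} [Fintype m] [Fintype n] (M : CStarMatrix m n A) :
    ‖M‖ ≤ ∑ j, ∑ i, ‖M i j‖ := by
  rw [norm_def]
  refine (toCLM M).opNorm_le_bound (by positivity) fun v => ?_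
  simp only [toCLM_apply_eq_sum, Finset.sum_mul]
  apply WithCStarModule.pi_norm_le_sum_norm _ |>.trans
  gcongr with i _
  apply norm_sum_le _ _ |>.trans
  gcongr with j _
  apply norm_mul_le _ _ |>.trans
  rw [mul_comm]
  gcongr
  exact WithCStarModule.norm_apply_le_norm v j

theorem sum_norm_entry_le {A : Type*} [CStarAlgebra A] [PartialOrder A] [StarOrderedRing A]
    {n : Type*} [Fintype n] (M : CStarMatrix n n A) :
    ∑ j, ∑ i, ‖M i j‖ ≤ (Fintype.card n : ℝ) ^ 2 * ‖M‖ := by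
  calc ∑ j, ∑ i, ‖M i j‖ ≤ ∑ _j : n, ∑ _i : n, ‖M‖ := by
        gcongr
        exact norm_entry_le_norm
    _ = _ := by simp; ring

end CStarMatrix

/-- The comparison behind the spectral radius formula: a quantity whose powers are comparable, up to
a factor independent of the exponent, with convergent quantities is itself convergent. -/
theorem tendsto_of_pow_comparable {I : Type*} {l : Filter I} {f : I → ℝ} {L C : ℝ}
    {s : ℕ → I → ℝ} {t : ℕ → ℝ} (hC : 0 ≤ C) (hf : ∀ i, 0 ≤ f i) (hL : 0 ≤ L)
    (hst : ∀ k, Tendsto (s k) l (𝓝 (t k)))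
    (hfs : ∀ k i, f i ^ 2 ^ k ≤ s k i) (hsf : ∀ k i, s k i ≤ C * f i ^ 2 ^ k)
    (hLt : ∀ k, L ^ 2 ^ k ≤ t k) (htL : ∀ k, t k ≤ C * L ^ 2 ^ k) : Tendsto f l (𝓝 L) := by
  -- The factor `C` is negligible for large exponents.
  have key : ∀ x y : ℝ, 0 ≤ x → x < y → ∃ k : ℕ, C * x ^ 2 ^ k < y ^ 2 ^ k := by
    intro x y hx hxy
    have hy : 0 < y := hx.trans_lt hxy
    have hq : x / y < 1 := (div_lt_one hy).2 hxy
    have h0 : Tendsto (fun m : ℕ => C * (x / y) ^ 2 ^ m) atTop (𝓝 (C * 0)) :=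
      ((tendsto_pow_atTop_nhds_zero_of_lt_one (by positivity) hq).comp
        (tendsto_pow_atTop_atTop_of_one_lt one_lt_two)).const_mul C
    rw [mul_zero] at h0
    obtain ⟨k, hk⟩ := (h0.eventually (gt_mem_nhds one_pos)).exists
    refine ⟨k, ?_⟩
    rwa [div_pow, ← mul_div_assoc, div_lt_one (by positivity)] at hk
  refine tendsto_order.2 ⟨fun a ha => ?_, fun a ha => ?_⟩
  · rcases lt_or_ge a 0 with h | h
    · exact Eventually.of_forall fun i => h.trans_le (hf i)
    obtain ⟨k, hk⟩ := key a L h ha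
    filter_upwards [(hst k).eventually (lt_mem_nhds (hk.trans_le (hLt k)))] with i hi
    have h1 := hi.trans_le (hsf k i)
    exact lt_of_pow_lt_pow_left₀ _ (hf i) (lt_of_mul_lt_mul_left h1 hC)
  · obtain ⟨k, hk⟩ := key L a hL ha
    filter_upwards [(hst k).eventually (gt_mem_nhds ((htL k).trans_lt hk))] with i hi
    exact lt_of_pow_lt_pow_left₀ _ (hL.trans ha.le) ((hfs k i).trans_lt hi)

theorem CStarMatrix.norm_star_mul_self_pow {A : Type*} [CStarAlgebra A] [PartialOrder A]
    [StarOrderedRing A] {n : Type*} [Fintype n] [DecidableEq n] (X : CStarMatrix n n A) (k : ℕ) :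
    ‖star X * X‖ ^ 2 ^ k = ‖(star X * X) ^ 2 ^ k‖ := by
  have := congrArg NNReal.toReal ((IsSelfAdjoint.star_mul_self X).nnnorm_pow_two_pow k)
  rw [NNReal.coe_pow] at this
  exact this.symm

/-- The norm of a matrix over a C⋆-algebra is determined by the norms in the C⋆-algebra itself: the
norm of the power `(X⋆X) ^ 2 ^ k` is `‖X‖ ^ (2 * 2 ^ k)`, and it is comparable, up to a factor
independent of `k`, to the sum of the norms of the entries. -/
theorem CStarMatrix.tendsto_norm_of_entries {A B : Type*} [CStarAlgebra A] [PartialOrder A]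
    [StarOrderedRing A] [CStarAlgebra B] [PartialOrder B] [StarOrderedRing B] {n : Type*}
    [Fintype n] [DecidableEq n] {I : Type*} {l : Filter I} {M : I → CStarMatrix n n A}
    {W : CStarMatrix n n B}
    (h : ∀ (k : ℕ) (i j : n), Tendsto (fun κ => ‖((star (M κ) * M κ) ^ k) i j‖) l
      (𝓝 ‖((star W * W) ^ k) i j‖)) :
    Tendsto (fun κ => ‖M κ‖) l (𝓝 ‖W‖) := by
  have hsq : Tendsto (fun κ => ‖star (M κ) * M κ‖) l (𝓝 ‖star W * W‖) := by
    refine tendsto_of_pow_comparable (C := (Fintype.card n : ℝ) ^ 2)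
      (s := fun k κ => ∑ j, ∑ i, ‖((star (M κ) * M κ) ^ 2 ^ k) i j‖)
      (t := fun k => ∑ j, ∑ i, ‖((star W * W) ^ 2 ^ k) i j‖)
      (by positivity) (fun _ => norm_nonneg _) (norm_nonneg _) (fun k => ?_)
      (fun k κ => ?_) (fun k κ => ?_) (fun k => ?_) (fun k => ?_)
    · exact tendsto_finsetSum _ fun j _ => tendsto_finsetSum _ fun i _ => h _ i j
    · rw [norm_star_mul_self_pow]; exact norm_le_sum_norm_entry _
    · rw [norm_star_mul_self_pow]; exact sum_norm_entry_le _
    · rw [norm_star_mul_self_pow]; exact norm_le_sum_norm_entry _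
    · rw [norm_star_mul_self_pow]; exact sum_norm_entry_le _
  have h2 := hsq.sqrt
  simpa only [CStarRing.norm_star_mul_self, Real.sqrt_mul_self (norm_nonneg _)] using h2

/-! ### Matrices of ⋆-polynomials -/

/-- The sum of a finite family of terms. -/
def CStarTerm.sum {V : Type} {n : ℕ} (f : Fin n → CStarTerm V) : CStarTerm V :=
  (List.ofFn f).foldr CStarTerm.add CStarTerm.zero

theorem CStarTerm.eval_sum {A : Type u} [CStarAlgebra A] {V : Type} (a : V → A) {n : ℕ}
    (f : Fin n → CStarTerm V) : (CStarTerm.sum f).eval a = ∑ i, (f i).eval a := by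
  have h : ∀ L : List (CStarTerm V),
      (L.foldr CStarTerm.add CStarTerm.zero).eval a = (L.map fun t => t.eval a).sum := by
    intro L
    induction L with
    | nil => rfl
    | cons t L ih =>
      rw [List.foldr_cons, CStarTerm.eval, ih, List.map_cons, List.sum_cons]
  rw [CStarTerm.sum, h, List.map_ofFn, List.sum_ofFn]
  rfl

theorem CStarTerm.continuous_eval {A : Type u} [CStarAlgebra A] {V : Type} (t : CStarTerm V) :
    Continuous fun a : V → A => t.eval a := by
  induction t with
  | var i => exact continuous_apply i
  | zero => exact continuous_const
  | one => exact continuous_const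
  | smul c s ih => exact ih.const_smul c
  | add s t ihs iht => exact ihs.add iht
  | mul s t ihs iht => exact ihs.mul iht
  | adj s ih => exact ih.star

theorem CStarTerm.eval_comp_starAlgHom {A B : Type u} [CStarAlgebra A] [CStarAlgebra B] {V : Type}
    (f : A →⋆ₐ[ℂ] B) (a : V → A) (t : CStarTerm V) : t.eval (fun i => f (a i)) = f (t.eval a) := by
  induction t with
  | var i => rfl
  | zero => exact (map_zero f).symm
  | one => exact (map_one f).symm
  | smul c s ih => simp only [CStarTerm.eval, ih, map_smul]
  | add s t ihs iht => simp only [CStarTerm.eval, ihs, iht, map_add]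
  | mul s t ihs iht => simp only [CStarTerm.eval, ihs, iht, map_mul]
  | adj s ih => simp only [CStarTerm.eval, ih, map_star]

/-- A square matrix of `⋆`-polynomials. -/
abbrev CStarTermMatrix (V : Type) (n : ℕ) : Type := Matrix (Fin n) (Fin n) (CStarTerm V)

namespace CStarTermMatrix

variable {V : Type} {n : ℕ}

/-- The value of a matrix of `⋆`-polynomials at an assignment of the variables. -/
def eval {A : Type u} [CStarAlgebra A] (v : V → A) (Q : CStarTermMatrix V n) :
    CStarMatrix (Fin n) (Fin n) A :=
  CStarMatrix.ofMatrix fun i j => (Q i j).eval v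

/-- The matrix `Q⋆R`. -/
def adjMul (Q R : CStarTermMatrix V n) : CStarTermMatrix V n :=
  fun i j => .sum fun k => .mul (.adj (Q k i)) (R k j)

/-- The identity matrix. -/
def id : CStarTermMatrix V n := fun i j => if i = j then .one else .zero

/-- The matrix `(Q⋆Q)ᵏ`, with `(Q⋆Q)ᵏ⁺¹` written as `((Q⋆Q)ᵏ)⋆(Q⋆Q)`. -/
def adjMulSelfPow (Q : CStarTermMatrix V n) : ℕ → CStarTermMatrix V n
  | 0 => id
  | k + 1 => adjMul (adjMulSelfPow Q k) (adjMul Q Q)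

variable {A : Type u} [CStarAlgebra A] (v : V → A)

@[simp]
theorem eval_apply (Q : CStarTermMatrix V n) (i j : Fin n) : eval v Q i j = (Q i j).eval v := rfl

theorem eval_adjMul (Q R : CStarTermMatrix V n) :
    eval v (adjMul Q R) = star (eval v Q) * eval v R := by
  ext i j
  simp [adjMul, CStarTerm.eval_sum, CStarTerm.eval, CStarMatrix.mul_apply, CStarMatrix.star_apply]

theorem eval_id : eval v (id : CStarTermMatrix V n) = 1 := by
  ext i j
  by_cases h : i = j <;> simp [id, h, CStarTerm.eval, CStarMatrix.one_apply]

theorem eval_adjMulSelfPow (Q : CStarTermMatrix V n) (k : ℕ) :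
    eval v (adjMulSelfPow Q k) = (star (eval v Q) * eval v Q) ^ k := by
  induction k with
  | zero => rw [adjMulSelfPow, eval_id, pow_zero]
  | succ k ih =>
    rw [adjMulSelfPow, eval_adjMul, ih, eval_adjMul, pow_succ,
      ((IsSelfAdjoint.star_mul_self (eval v Q)).pow k).star_eq]

/-- Norms of matrices of `⋆`-polynomials converge if norms of `⋆`-polynomials do. -/
theorem tendsto_norm_eval {A B : Type u} [CStarAlgebra A] [PartialOrder A] [StarOrderedRing A]
    [CStarAlgebra B] [PartialOrder B] [StarOrderedRing B] {I : Type*} {l : Filter I}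
    {v : I → V → A} {w : V → B}
    (h : ∀ P : CStarTerm V, Tendsto (fun i => ‖P.eval (v i)‖) l (𝓝 ‖P.eval w‖))
    (Q : CStarTermMatrix V n) : Tendsto (fun i => ‖eval (v i) Q‖) l (𝓝 ‖eval w Q‖) := by
  refine CStarMatrix.tendsto_norm_of_entries fun k i j => ?_
  simpa only [← eval_adjMulSelfPow, eval_apply] using h (adjMulSelfPow Q k i j)

end CStarTermMatrix

/-! ### Terms for operator systems as matrices of ⋆-polynomials -/

namespace OpSysSort

/-- Elements of sort `s` whose matrix entries are `⋆`-polynomials. Scalars stay fixed. -/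
abbrev TermVal (V : Type) : OpSysSort → Type
  | mat n => CStarTermMatrix V n
  | cone n => CStarTermMatrix V n
  | scal m n => CStarMatrix (Fin m) (Fin n) ℂ
  | nonneg => ℝ≥0

/-- The value in a C⋆-algebra of an element with polynomial entries. -/
def TermVal.eval {V : Type} {A : Type u} [CStarAlgebra A] (v : V → A) :
    (s : OpSysSort) → s.TermVal V → s.Val A
  | mat _, Q => CStarTermMatrix.eval v Q
  | cone _, Q => CStarTermMatrix.eval v Q
  | scal _ _, x => ⟨x⟩
  | nonneg, x => ⟨x⟩

end OpSysSort

/-- The polynomial entries of `A⋆XA`. -/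
def CStarTermMatrix.scalarConj {V : Type} {m n : ℕ} (A : CStarMatrix (Fin m) (Fin n) ℂ)
    (X : CStarTermMatrix V m) : CStarTermMatrix V n :=
  fun i j => .sum fun k => .sum fun l => .smul (star (A k i) * A l j) (X k l)

/-- The value of a term of the language of operator systems, computed with matrices of
`⋆`-polynomials. -/
def OpSysTerm.termEval {V : Type} {I : Type} {σ : I → OpSysSort} (Q : ∀ i, (σ i).TermVal V) :
    {s : OpSysSort} → OpSysTerm σ s → s.TermVal V
  | _, .var i => Q i
  | _, .zero => fun _ _ => .zero
  | _, .one => fun _ _ => .one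
  | _, .add x y => fun i j => .add (x.termEval Q i j) (y.termEval Q i j)
  | _, .adj x => fun i j => .adj (x.termEval Q j i)
  | _, .smul c x => fun i j => .smul (c.termEval Q 0 0) (x.termEval Q i j)
  | _, .conj A x => CStarTermMatrix.scalarConj (A.termEval Q) (x.termEval Q)
  | _, .coneAdd x y => fun i j => .add (x.termEval Q i j) (y.termEval Q i j)
  | _, .coneSmul r x => fun i j => .smul ((r.termEval Q : ℝ) : ℂ) (x.termEval Q i j)
  | _, .coneConj A x => CStarTermMatrix.scalarConj (A.termEval Q) (x.termEval Q)
  | _, .incl x => x.termEval Q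
  | _, .block x =>
      Matrix.reindex finSumFinEquiv finSumFinEquiv
        (Matrix.fromBlocks CStarTermMatrix.id (x.termEval Q)
          (fun i j => .adj (x.termEval Q j i)) CStarTermMatrix.id)
  | _, .entry i j x => fun _ _ => x.termEval Q i j
  | _, .scalEntry i j A => oneByOne (A.termEval Q i j)
  | _, .scalAdd A C => A.termEval Q + C.termEval Q
  | _, .scalMul A C => A.termEval Q * C.termEval Q
  | _, .scalAdj A => (A.termEval Q).conjTranspose
  | _, .scalOne => oneByOne 1
  | _, .scalI => oneByOne Complex.I

theorem CStarTermMatrix.eval_scalarConj {V : Type} {A : Type u} [CStarAlgebra A] (v : V → A)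
    {m n : ℕ} (C : CStarMatrix (Fin m) (Fin n) ℂ) (X : CStarTermMatrix V m) :
    eval v (scalarConj C X) = _root_.scalarConj C (eval v X) := by
  ext i j
  simp only [scalarConj, CStarTerm.eval_sum, CStarTerm.eval, eval_apply]
  rfl

theorem OpSysTerm.eval_termEval {V : Type} {I : Type} {σ : I → OpSysSort} {A : Type u}
    [CStarAlgebra A] [PartialOrder A] [StarOrderedRing A]
    (Q : ∀ i, (σ i).TermVal V) (v : V → A) {s : OpSysSort} (t : OpSysTerm σ s) :
    t.eval (fun i => TermVal.eval v (σ i) (Q i)) = TermVal.eval v s (t.termEval Q) := by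
  induction t with
  | var i => rfl
  | zero => rfl
  | one => rfl
  | add x y ihx ihy => rw [OpSysTerm.eval, ihx, ihy]; rfl
  | adj x ih => exact congrArg star ih
  | smul c x ihc ih => rw [OpSysTerm.eval, ihc, ih]; rfl
  | conj C x ihC ih =>
    rw [OpSysTerm.eval, ihC, ih]; exact (CStarTermMatrix.eval_scalarConj v _ _).symm
  | coneAdd x y ihx ihy => rw [OpSysTerm.eval, ihx, ihy]; rfl
  | coneSmul r x ihr ih => rw [OpSysTerm.eval, ihr, ih]; rfl
  | coneConj C x ihC ih =>
    rw [OpSysTerm.eval, ihC, ih]; exact (CStarTermMatrix.eval_scalarConj v _ _).symm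
  | incl x ih => rw [OpSysTerm.eval, ih]; rfl
  | @block n x ih =>
    rw [OpSysTerm.eval, ih]
    ext i j
    have h1 := fun a b => congrFun (congrFun (CStarTermMatrix.eval_id (n := n) v) a) b
    obtain ⟨i, rfl⟩ := finSumFinEquiv.surjective i
    obtain ⟨j, rfl⟩ := finSumFinEquiv.surjective j
    simp only [selfAdjointBlock, TermVal.eval, OpSysTerm.termEval, CStarTermMatrix.eval_apply,
      CStarMatrix.ofMatrix_apply, Matrix.reindex_apply, Matrix.submatrix_apply,
      Equiv.symm_apply_apply]
    rcases i with i | i <;> rcases j with j | j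
    · exact (h1 i j).symm
    · rfl
    · rfl
    · exact (h1 i j).symm
  | entry i j x ih => rw [OpSysTerm.eval, ih]; rfl
  | scalEntry i j C ih => rw [OpSysTerm.eval, ih]; rfl
  | scalAdd C D ihC ihD => rw [OpSysTerm.eval, ihC, ihD]; rfl
  | scalMul C D ihC ihD => rw [OpSysTerm.eval, ihC, ihD]; rfl
  | scalAdj C ih => rw [OpSysTerm.eval, ih]; rfl
  | scalOne => rfl
  | scalI => rfl

/-- If the norms of all `⋆`-polynomials converge, then so do the values of all quantifier-free
formulas of the language of operator systems. -/
theorem OpSysQF.tendsto_eval {V : Type} {J : Type} {σ : J → OpSysSort} {A B : Type u}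
    [CStarAlgebra A] [PartialOrder A] [StarOrderedRing A]
    [CStarAlgebra B] [PartialOrder B] [StarOrderedRing B] {I : Type*} {l : Filter I}
    {v : I → V → A} {w : V → B}
    (h : ∀ P : CStarTerm V, Tendsto (fun i => ‖P.eval (v i)‖) l (𝓝 ‖P.eval w‖))
    (Q : ∀ j, (σ j).TermVal V) (φ : OpSysQF σ) :
    Tendsto (fun i => φ.eval fun j => TermVal.eval (v i) (σ j) (Q j)) l
      (𝓝 (φ.eval fun j => TermVal.eval w (σ j) (Q j))) := by
  have hsub : ∀ {C : Type u} [CStarAlgebra C] {n : ℕ} (c : V → C) (X Y : CStarTermMatrix V n),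
      CStarTermMatrix.eval c X - CStarTermMatrix.eval c Y =
        CStarTermMatrix.eval c (fun i j => .add (X i j) (.smul (-1) (Y i j))) := by
    intro C _ n c X Y
    ext i j
    change (X i j).eval c - (Y i j).eval c = (X i j).eval c + (-1 : ℂ) • (Y i j).eval c
    rw [neg_one_smul, sub_eq_add_neg]
  induction φ with
  | norm x =>
    simp only [OpSysQF.eval, OpSysTerm.eval_termEval]
    exact CStarTermMatrix.tendsto_norm_eval h _
  | @dist s x y =>
    simp only [OpSysQF.eval, OpSysTerm.eval_termEval]
    generalize x.termEval Q = X
    generalize y.termEval Q = Y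
    cases s with
    | mat n =>
      simp only [Val.dist, TermVal.eval, hsub]
      exact CStarTermMatrix.tendsto_norm_eval h _
    | cone n =>
      simp only [Val.dist, TermVal.eval, hsub]
      exact CStarTermMatrix.tendsto_norm_eval h _
    | scal m n => exact tendsto_const_nhds
    | nonneg => exact tendsto_const_nhds
  | conn c hc φ ih =>
    exact (hc.tendsto _).comp (tendsto_pi_nhds.2 ih)

/-! ### Existentially closed C⋆-algebras -/

theorem sInf_eq_of_subset_of_subset_closure {S T : Set ℝ} (h : S ⊆ T) (h' : T ⊆ closure S) :
    sInf S = sInf T := by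
  have hlb : lowerBounds S = lowerBounds T :=
    ((lowerBounds_closure S).symm.subset.trans (lowerBounds_mono_set h')).antisymm
      (lowerBounds_mono_set h)
  rcases T.eq_empty_or_nonempty with rfl | hT
  · rw [Set.subset_empty_iff.1 h]
  have hS : S.Nonempty := closure_nonempty_iff.1 (hT.mono h')
  by_cases hb : BddBelow S
  · have hb' : BddBelow T := by rwa [BddBelow, ← hlb]
    have h1 := isGLB_csInf hS hb
    have h2 := isGLB_csInf hT hb'
    rw [IsGLB, hlb] at h1
    exact h1.unique h2
  · have hb' : ¬BddBelow T := by rwa [BddBelow, ← hlb]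
    rw [Real.sInf_of_not_bddBelow hb, Real.sInf_of_not_bddBelow hb']

/-- If `A` is existentially closed and `A ⊆ B`, then elements of `B` are approximated by elements of
`A`: along a filter, the norm of each `⋆`-polynomial over `A` converges to its norm at the given
elements of `B`. -/
theorem IsExistentiallyClosedCStarAlgebra.exists_tendsto_norm_eval {A : Type u} [CStarAlgebra A]
    (hA : IsExistentiallyClosedCStarAlgebra A) {B : Type u} [CStarAlgebra B] (ι : A →⋆ₐ[ℂ] B)
    (hι : Function.Injective ι) {p q : ℕ} (a : Fin p → A) (b : Fin q → B) :
    ∃ (I : Type) (l : Filter I) (c : I → Fin q → A), l.NeBot ∧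
      ∀ P : CStarTerm (Fin p ⊕ Fin q), Tendsto (fun i => ‖P.eval (Sum.elim a (c i))‖) l
        (𝓝 ‖P.eval (Sum.elim (fun j => ι (a j)) b)‖) := by
  set r : CStarTerm (Fin p ⊕ Fin q) → ℝ := fun P => ‖P.eval (Sum.elim (fun j => ι (a j)) b)‖
    with hr
  have key : ∀ (F : Finset (CStarTerm (Fin p ⊕ Fin q))) (n : ℕ), ∃ c : Fin q → A,
      ∀ P ∈ F, |‖P.eval (Sum.elim a c)‖ - r P| < 1 / ((n : ℝ) + 1) := by
    intro F n
    let φ : CStarQF (Fin p ⊕ Fin q) :=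
      .conn (k := F.card) (fun x => ∑ i, |x i - r (F.equivFin.symm i)|) (by fun_prop)
        fun i => .norm (F.equivFin.symm i)
    obtain ⟨N, hN⟩ : ∃ N : ℕ, ∀ j, ‖b j‖ ≤ N := by
      obtain ⟨x, hx⟩ := (Set.finite_range fun j => ‖b j‖).bddAbove
      obtain ⟨N, hN⟩ := exists_nat_ge x
      exact ⟨N, fun j => (hx ⟨j, rfl⟩).trans hN⟩
    have hval : φ.existsValue (N + 1) (fun i => ι (a i)) = 0 := by
      refine IsLeast.csInf_eq ⟨⟨b, fun j => (hN j).trans (by simp), ?_⟩, ?_⟩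
      · simp [φ, CStarQF.eval, hr]
      · rintro x ⟨b', -, rfl⟩
        exact Finset.sum_nonneg fun _ _ => abs_nonneg _
    rw [← hA B ι hι p q φ (N + 1) (by omega) a] at hval
    have hne : {r : ℝ | ∃ b : Fin q → A, (∀ j, ‖b j‖ ≤ ((N + 1 : ℕ) : ℝ)) ∧
        r = φ.eval (Sum.elim a b)}.Nonempty :=
      ⟨_, 0, fun j => by rw [Pi.zero_apply, norm_zero]; positivity, rfl⟩
    have hlt : φ.existsValue (N + 1) a < 1 / ((n : ℝ) + 1) := by rw [hval]; positivity
    obtain ⟨_, ⟨c, -, rfl⟩, hc⟩ := exists_lt_of_csInf_lt hne hlt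
    refine ⟨c, fun P hP => lt_of_le_of_lt ?_ hc⟩
    have := Finset.single_le_sum (s := Finset.univ)
      (f := fun i => |‖(F.equivFin.symm i : CStarTerm (Fin p ⊕ Fin q)).eval (Sum.elim a c)‖ -
        r (F.equivFin.symm i)|) (fun _ _ => abs_nonneg _) (Finset.mem_univ (F.equivFin ⟨P, hP⟩))
    simpa [φ, CStarQF.eval] using this
  choose c hc using key
  classical
  refine ⟨Finset (CStarTerm (Fin p ⊕ Fin q)) × ℕ, atTop, fun i => c i.1 i.2, inferInstance,
    fun P => ?_⟩
  rw [Metric.tendsto_nhds]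
  intro ε hε
  obtain ⟨n, hn⟩ := exists_nat_one_div_lt hε
  filter_upwards [eventually_ge_atTop (({P}, n) : Finset (CStarTerm (Fin p ⊕ Fin q)) × ℕ)]
    with i hi
  rw [Real.dist_eq]
  refine (hc i.1 i.2 P (hi.1 (Finset.mem_singleton_self P))).trans (lt_of_le_of_lt ?_ hn)
  exact one_div_le_one_div_of_le (by positivity)
    (by have : (n : ℝ) ≤ i.2 := by exact_mod_cast hi.2
        linarith)

theorem exists_star_mul_self_eq_of_nonneg {D : Type*} [CStarAlgebra D] [PartialOrder D]
    [StarOrderedRing D] {x : D} (hx : 0 ≤ x) : ∃ z, star z * z = x :=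
  (CStarAlgebra.nonneg_iff_eq_star_mul_self.1 hx).imp fun _ h => h.symm

theorem CStarMatrix.map_star_mul_self {A B : Type*} [CStarAlgebra A] [CStarAlgebra B]
    (f : A →⋆ₐ[ℂ] B) {n : Type*} [Fintype n] (M : CStarMatrix n n A) :
    (star M * M).map f = star (M.map f) * M.map f := by
  ext i j
  simp [CStarMatrix.mul_apply, CStarMatrix.star_apply, map_star]

namespace OpSysSort

/-- The number of rows of the matrices over the operator system which are the elements of the
sort `s`; it is zero for the scalar sorts. -/
def size : OpSysSort → ℕ
  | mat n => n
  | cone n => n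
  | scal _ _ => 0
  | nonneg => 0

/-- The scalar parts of the elements of sort `s`. -/
abbrev Scalar : OpSysSort → Type
  | mat _ => Unit
  | cone _ => Unit
  | scal m n => CStarMatrix (Fin m) (Fin n) ℂ
  | nonneg => ℝ≥0

/-- An element of sort `s` with polynomial entries: `T` itself for a matrix sort, `T⋆T` for a cone,
and the scalar `c` for a scalar sort. Every element of sort `s` over a C⋆-algebra has this form. -/
def paramTerm {V : Type} : (s : OpSysSort) → CStarTermMatrix V s.size → s.Scalar → s.TermVal V
  | mat _, T, _ => T
  | cone _, T, _ => CStarTermMatrix.adjMul T T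
  | scal _ _, _, c => c
  | nonneg, _, c => c

/-- The values of `OpSysSort.paramTerm`. -/
def ofParam {A : Type u} [CStarAlgebra A] :
    (s : OpSysSort) → CStarMatrix (Fin s.size) (Fin s.size) A → s.Scalar → s.Val A
  | mat _, M, _ => M
  | cone _, M, _ => star M * M
  | scal _ _, _, c => ⟨c⟩
  | nonneg, _, c => ⟨c⟩

theorem eval_paramTerm {V : Type} {A : Type u} [CStarAlgebra A] (v : V → A) (s : OpSysSort)
    (T : CStarTermMatrix V s.size) (c : s.Scalar) :
    TermVal.eval v s (paramTerm s T c) = ofParam s (CStarTermMatrix.eval v T) c := by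
  cases s with
  | mat n => rfl
  | cone n => exact CStarTermMatrix.eval_adjMul v T T
  | scal m n => rfl
  | nonneg => rfl

variable {A B : Type u} [CStarAlgebra A] [CStarAlgebra B]

theorem ofParam_mem_dom [PartialOrder A] [StarOrderedRing A] (s : OpSysSort)
    (M : CStarMatrix (Fin s.size) (Fin s.size) A) (c : s.Scalar) :
    ofParam s M c ∈ Dom (OperatorSystem.whole A) s := by
  cases s with
  | mat n => exact fun _ _ => trivial
  | cone n => exact ⟨star_mul_self_nonneg M, fun _ _ => trivial⟩
  | scal m n => trivial
  | nonneg => trivial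

theorem exists_ofParam_eq [PartialOrder A] [StarOrderedRing A] {s : OpSysSort} {x : s.Val A}
    (hx : x ∈ Dom (OperatorSystem.whole A) s) : ∃ M c, ofParam s M c = x := by
  cases s with
  | mat n => exact ⟨x, (), rfl⟩
  | cone n =>
    obtain ⟨z, hz⟩ := exists_star_mul_self_eq_of_nonneg (D := CStarMatrix (Fin n) (Fin n) A) hx.1
    exact ⟨z, (), hz⟩
  | scal m n => exact ⟨0, x.down, rfl⟩
  | nonneg => exact ⟨0, x.down, rfl⟩

theorem map_ofParam (f : A →⋆ₐ[ℂ] B) (s : OpSysSort)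
    (M : CStarMatrix (Fin s.size) (Fin s.size) A) (c : s.Scalar) :
    Val.map f s (ofParam s M c) = ofParam s (M.map f) c := by
  cases s with
  | mat n => rfl
  | cone n =>
    exact CStarMatrix.map_star_mul_self f (M : CStarMatrix (Fin n) (Fin n) A)
  | scal m n => rfl
  | nonneg => rfl

/-- If `M` gives an element of size at most `N`, then the approximations of the element given by
`r • M`, for `r < 1`, eventually have size at most `N`: for matrix sorts the limit has size strictly
below `N`, and elements of scalar sorts do not depend on `M`. -/
theorem eventually_size_le_of_tendsto [PartialOrder A] [StarOrderedRing A] [PartialOrder B]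
    [StarOrderedRing B] {V : Type} {I : Type*} {l : Filter I} {v : I → V → A} {w : V → B}
    (h : ∀ P : CStarTerm V, Tendsto (fun i => ‖P.eval (v i)‖) l (𝓝 ‖P.eval w‖))
    {s : OpSysSort} {T : CStarTermMatrix V s.size} {c : s.Scalar}
    {M : CStarMatrix (Fin s.size) (Fin s.size) B} {r N : ℝ} (hr : 0 ≤ r) (hr1 : r < 1)
    (hN : 0 < N) (hT : CStarTermMatrix.eval w T = (r : ℂ) • M)
    (hs : Val.size s (ofParam s M c) ≤ N) :
    ∀ᶠ i in l, Val.size s (TermVal.eval (v i) s (paramTerm s T c)) ≤ N := by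
  have hnorm : ‖(r : ℂ)‖ = r := by simp [abs_of_nonneg hr]
  cases s with
  | mat n =>
    have h1 := CStarTermMatrix.tendsto_norm_eval h T
    rw [hT, norm_smul, hnorm] at h1
    have h2 : r * ‖M‖ < N := lt_of_le_of_lt (mul_le_mul_of_nonneg_left hs hr) (by nlinarith)
    filter_upwards [h1.eventually (gt_mem_nhds h2)] with i hi using hi.le
  | cone n =>
    have h1 := CStarTermMatrix.tendsto_norm_eval h (CStarTermMatrix.adjMul T T)
    rw [CStarTermMatrix.eval_adjMul, CStarRing.norm_star_mul_self, hT, norm_smul, hnorm] at h1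
    have hs' : ‖M‖ * ‖M‖ ≤ N := by
      rw [← CStarRing.norm_star_mul_self]
      exact hs
    have h2 : r * ‖M‖ * (r * ‖M‖) < N := by
      have : r * ‖M‖ * (r * ‖M‖) = r * r * (‖M‖ * ‖M‖) := by ring
      rw [this]
      exact lt_of_le_of_lt (mul_le_mul_of_nonneg_left hs' (by positivity))
        (by nlinarith [mul_lt_one_of_nonneg_of_lt_one_left hr hr1 hr1.le])
    filter_upwards [h1.eventually (gt_mem_nhds h2)] with i hi using hi.le
  | scal m n => exact Eventually.of_forall fun _ => hs
  | nonneg => exact Eventually.of_forall fun _ => hs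


/-- Elements of the sorts `σ j` with pairwise distinct variables as matrix entries, the variables
being named by `g`, and with given scalars. -/
def entryTerm {V J : Type} (σ : J → OpSysSort)
    (g : (Σ j, Fin (σ j).size × Fin (σ j).size) → V) (d : ∀ j, (σ j).Scalar) (j : J) :
    (σ j).TermVal V :=
  paramTerm (σ j) (Matrix.of fun x y => .var (g ⟨j, x, y⟩)) (d j)

theorem eval_entryTerm {V J : Type} {σ : J → OpSysSort}
    {g : (Σ j, Fin (σ j).size × Fin (σ j).size) → V} {d : ∀ j, (σ j).Scalar} {v : V → A} {j : J}
    {M : CStarMatrix (Fin (σ j).size) (Fin (σ j).size) A} (h : ∀ x y, v (g ⟨j, x, y⟩) = M x y) :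
    TermVal.eval v (σ j) (entryTerm σ g d j) = ofParam (σ j) M (d j) := by
  rw [entryTerm, eval_paramTerm]
  congr 1
  exact CStarMatrix.ext h

end OpSysSort

/-- Injective unital `⋆`-homomorphisms preserve the values of quantifier-free formulas of the
language of operator systems: they preserve the norm of each `⋆`-polynomial. -/
theorem OpSysQF.eval_map {A B : Type u} [CStarAlgebra A] [PartialOrder A] [StarOrderedRing A]
    [CStarAlgebra B] [PartialOrder B] [StarOrderedRing B] (f : A →⋆ₐ[ℂ] B)
    (hf : Function.Injective f) {J : Type} {σ : J → OpSysSort} (φ : OpSysQF σ)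
    {a : ∀ j, (σ j).Val A} (ha : ∀ j, a j ∈ Dom (OperatorSystem.whole A) (σ j)) :
    φ.eval (fun j => Val.map f (σ j) (a j)) = φ.eval a := by
  choose M c hMc using fun j => exists_ofParam_eq (ha j)
  let v : (Σ j, Fin (σ j).size × Fin (σ j).size) → A := fun x => M x.1 x.2.1 x.2.2
  have h : ∀ P : CStarTerm (Σ j, Fin (σ j).size × Fin (σ j).size),
      Tendsto (fun _ : Unit => ‖P.eval v‖) ⊤ (𝓝 ‖P.eval fun x => f (v x)‖) := by
    intro P
    rw [CStarTerm.eval_comp_starAlgHom, NonUnitalStarAlgHom.norm_map f hf]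
    exact tendsto_const_nhds
  have h1 := OpSysQF.tendsto_eval h (entryTerm σ _root_.id c) φ
  have h2 : (fun j => TermVal.eval v (σ j) (entryTerm σ _root_.id c j)) = a := by
    funext j
    rw [eval_entryTerm (M := M j) fun _ _ => rfl, hMc]
  have h3 : (fun j => TermVal.eval (fun x => f (v x)) (σ j) (entryTerm σ _root_.id c j)) =
      fun j => Val.map f (σ j) (a j) := by
    funext j
    rw [eval_entryTerm (M := (M j).map f) fun _ _ => rfl, ← map_ofParam, hMc]
  rw [h2, h3] at h1
  exact tendsto_nhds_unique h1 tendsto_const_nhds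

theorem OpSysSort.Val.size_map {A B : Type u} [CStarAlgebra A] [PartialOrder A]
    [StarOrderedRing A] [CStarAlgebra B] [PartialOrder B] [StarOrderedRing B] (f : A →⋆ₐ[ℂ] B)
    (hf : Function.Injective f) (s : OpSysSort) {x : s.Val A}
    (hx : x ∈ Dom (OperatorSystem.whole A) s) : Val.size s (Val.map f s x) = Val.size s x := by
  cases s with
  | mat n =>
    exact OpSysQF.eval_map f hf (σ := fun _ : Unit => mat n) (.norm (.var ()))
      (a := fun _ => x) fun _ => hx
  | cone n =>
    exact OpSysQF.eval_map f hf (σ := fun _ : Unit => cone n) (.norm (.incl (.var ())))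
      (a := fun _ => x) fun _ => hx
  | scal m n => rfl
  | nonneg => rfl

theorem OpSysSort.Val.map_mem_dom_whole {A B : Type u} [CStarAlgebra A] [PartialOrder A]
    [StarOrderedRing A] [CStarAlgebra B] [PartialOrder B] [StarOrderedRing B] (f : A →⋆ₐ[ℂ] B)
    {s : OpSysSort} {x : s.Val A} (hx : x ∈ Dom (OperatorSystem.whole A) s) :
    Val.map f s x ∈ Dom (OperatorSystem.whole B) s := by
  obtain ⟨M, c, rfl⟩ := exists_ofParam_eq hx
  rw [map_ofParam]
  exact ofParam_mem_dom _ _ _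

/-- Witnesses in `B` for an existential formula are approximated by witnesses in `A`: they are
scaled down slightly, written with `⋆`-polynomials (cone elements as `Z⋆Z`, scalars being kept), and
the variables of the `⋆`-polynomials are approximated in `A`. -/
theorem IsExistentiallyClosedCStarAlgebra.exists_approx_opSysQF {A : Type u} [CStarAlgebra A]
    [PartialOrder A] [StarOrderedRing A] (hA : IsExistentiallyClosedCStarAlgebra A) {B : Type u}
    [CStarAlgebra B] [PartialOrder B] [StarOrderedRing B] (ι : A →⋆ₐ[ℂ] B)
    (hι : Function.Injective ι) {p q : ℕ} {Γ : Fin p → OpSysSort} {Δ : Fin q → OpSysSort}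
    (φ : OpSysQF (Sum.elim Γ Δ)) {N : Fin q → ℕ} (hN : ∀ j, 1 ≤ N j) {a : ∀ i, (Γ i).Val A}
    (ha : ∀ i, a i ∈ Dom (OperatorSystem.whole A) (Γ i)) {b : ∀ j, (Δ j).Val B}
    (hb : ∀ j, b j ∈ Dom (OperatorSystem.whole B) (Δ j) ∧ Val.size (Δ j) (b j) ≤ N j)
    {ε : ℝ} (hε : 0 < ε) :
    ∃ b' : ∀ j, (Δ j).Val A,
      (∀ j, b' j ∈ Dom (OperatorSystem.whole A) (Δ j) ∧ Val.size (Δ j) (b' j) ≤ N j) ∧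
      |φ.eval (fun | .inl i => a i | .inr j => b' j) -
        φ.eval (fun | .inl i => Val.map ι (Γ i) (a i) | .inr j => b j)| < ε := by
  choose M c hMc using fun i => exists_ofParam_eq (ha i)
  choose W d hWd using fun j => exists_ofParam_eq (hb j).1
  let eΓ := Fintype.equivFin (Σ i, Fin (Γ i).size × Fin (Γ i).size)
  let eΔ := Fintype.equivFin (Σ j, Fin (Δ j).size × Fin (Δ j).size)
  let va := fun x => M (eΓ.symm x).1 (eΓ.symm x).2.1 (eΓ.symm x).2.2
  let wb := fun x => W (eΔ.symm x).1 (eΔ.symm x).2.1 (eΔ.symm x).2.2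
  let Q : ∀ x, (Sum.elim Γ Δ x).TermVal _
    | .inl i => entryTerm Γ (fun x => Sum.inl (eΓ x)) c i
    | .inr j => entryTerm Δ (fun x => Sum.inr (eΔ x)) d j
  have hva : ∀ z, va (eΓ z) = M z.1 z.2.1 z.2.2 := fun z => by
    simp only [va]
    rw [Equiv.symm_apply_apply]
  have hwb : ∀ z, wb (eΔ z) = W z.1 z.2.1 z.2.2 := fun z => by
    simp only [wb]
    rw [Equiv.symm_apply_apply]
  have hQa : ∀ (z : _ → B) (i : Fin p), TermVal.eval (Sum.elim (fun x => ι (va x)) z) (Γ i)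
      (Q (.inl i)) = Val.map ι (Γ i) (a i) := by
    intro z i
    rw [← hMc i, map_ofParam]
    exact eval_entryTerm fun x y => by simp [hva]
  have hQb : ∀ (r : ℝ) (j : Fin q),
      TermVal.eval (Sum.elim (fun x => ι (va x)) fun x => (r : ℂ) • wb x) (Δ j) (Q (.inr j)) =
        ofParam (Δ j) ((r : ℂ) • W j) (d j) :=
    fun r j => eval_entryTerm fun x y => by simp [hwb]
  have hcont : ∀ P : CStarTerm _, Tendsto
      (fun r : ℝ => ‖P.eval (Sum.elim (fun x => ι (va x)) fun x => (r : ℂ) • wb x)‖) (𝓝[<] 1)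
      (𝓝 ‖P.eval (Sum.elim (fun x => ι (va x)) fun x => ((1 : ℝ) : ℂ) • wb x)‖) := by
    intro P
    refine Tendsto.mono_left (Continuous.tendsto ?_ 1) nhdsWithin_le_nhds
    refine (P.continuous_eval.comp (continuous_pi fun x => ?_)).norm
    rcases x with x | x
    · exact continuous_const
    · exact Complex.continuous_ofReal.smul continuous_const
  have hlim := OpSysQF.tendsto_eval hcont Q φ
  -- Scaling by `r < 1` leaves room for the norm estimates of the approximation in `A`.
  obtain ⟨r, hr, hr0, hr1⟩ := ((Metric.tendsto_nhds.1 hlim (ε / 2) (half_pos hε)).and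
    (Ioo_mem_nhdsLT (zero_lt_one' ℝ))).exists
  obtain ⟨I, l, v, hl, hv⟩ := hA.exists_tendsto_norm_eval ι hι va fun x => (r : ℂ) • wb x
  have hlim' := OpSysQF.tendsto_eval hv Q φ
  have hsize : ∀ j, ∀ᶠ i in l,
      Val.size (Δ j) (TermVal.eval (Sum.elim va (v i)) (Δ j) (Q (.inr j))) ≤ N j := by
    intro j
    refine eventually_size_le_of_tendsto hv (M := W j) hr0.le hr1 (by exact_mod_cast hN j) ?_
      (by rw [hWd]; exact (hb j).2)
    exact CStarMatrix.ext fun x y => by simp [CStarTerm.eval, hwb]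
  obtain ⟨i, hi, hi'⟩ := ((Metric.tendsto_nhds.1 hlim' (ε / 2) (half_pos hε)).and
    (eventually_all.2 hsize)).exists
  refine ⟨fun j => TermVal.eval (Sum.elim va (v i)) (Δ j) (Q (.inr j)), fun j => ⟨?_, hi' j⟩, ?_⟩
  · change TermVal.eval _ (Δ j) (paramTerm _ _ _) ∈ _
    rw [eval_paramTerm]
    exact ofParam_mem_dom _ _ _
  have hA' : (fun x => TermVal.eval (Sum.elim va (v i)) (Sum.elim Γ Δ x) (Q x)) =
      (fun | .inl i => a i | .inr j => TermVal.eval (Sum.elim va (v i)) (Δ j) (Q (.inr j)) :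
        ∀ x, (Sum.elim Γ Δ x).Val A) := by
    funext x
    rcases x with x | x
    · refine Eq.trans ?_ (hMc x)
      exact eval_entryTerm (σ := Γ) (M := M x) fun y z => by simp [hva]
    · rfl
  have hB' : (fun x => TermVal.eval (Sum.elim (fun x => ι (va x)) fun x => ((1 : ℝ) : ℂ) • wb x)
      (Sum.elim Γ Δ x) (Q x)) =
      (fun | .inl i => Val.map ι (Γ i) (a i) | .inr j => b j : ∀ x, (Sum.elim Γ Δ x).Val B) := by
    funext x
    rcases x with x | x
    · exact hQa _ x
    · refine (hQb 1 x).trans ?_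
      rw [Complex.ofReal_one, one_smul, hWd]
  rw [← hA', ← hB', ← Real.dist_eq]
  calc _ ≤ _ := dist_triangle _ _ _
    _ < ε / 2 + ε / 2 := add_lt_add hi hr
    _ = ε := add_halves ε

theorem IsExistentiallyClosedCStarAlgebra.isSemiExistentiallyClosed {A : Type u} [CStarAlgebra A]
    [PartialOrder A] [StarOrderedRing A] (hA : IsExistentiallyClosedCStarAlgebra A) :
    IsSemiExistentiallyClosed A := by
  intro B _ _ _ ι hι
  refine ⟨hι, fun _ _ => trivial, fun p q Γ Δ φ N hN a ha => ?_⟩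
  refine sInf_eq_of_subset_of_subset_closure ?_ ?_
  · rintro _ ⟨b, hb, rfl⟩
    refine ⟨fun j => Val.map ι (Δ j) (b j), fun j => ⟨Val.map_mem_dom_whole ι (hb j).1, ?_⟩, ?_⟩
    · rw [Val.size_map ι hι _ (hb j).1]
      exact (hb j).2
    · rw [← OpSysQF.eval_map ι hι]
      · congr 1
        funext x
        rcases x with x | x <;> rfl
      · rintro (x | x)
        exacts [ha x, (hb x).1]
  · rintro _ ⟨b, hb, rfl⟩
    refine Metric.mem_closure_iff.2 fun ε hε => ?_
    obtain ⟨b', hb', h⟩ := hA.exists_approx_opSysQF ι hι φ hN ha hb hε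
    exact ⟨_, ⟨b', hb', rfl⟩, by rwa [dist_comm, Real.dist_eq]⟩

/-! ### Approximate completely positive maps from existential closedness -/

/-- The elements of the sorts of the operator system `B` for which an approximation is sought:
elements of `B` and positive matrices over `B`. -/
inductive ApproxVar (B : Type u) [CStarAlgebra B] [PartialOrder B] [StarOrderedRing B] : Type u
  | elt (b : B)
  | pos (n : ℕ) (T : CStarMatrix (Fin n) (Fin n) B) (hT : 0 ≤ T)

namespace ApproxVar

variable {B : Type u} [CStarAlgebra B] [PartialOrder B] [StarOrderedRing B]

/-- The sort of an element to be approximated. -/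
abbrev sort : ApproxVar B → OpSysSort
  | elt _ => mat 1
  | pos n _ _ => cone n

/-- The element to be approximated. -/
def val : (x : ApproxVar B) → x.sort.Val B
  | elt b => oneByOne b
  | pos _ T _ => T

theorem val_mem_dom (x : ApproxVar B) : x.val ∈ Dom (OperatorSystem.whole B) x.sort := by
  cases x with
  | elt b => exact fun _ _ => trivial
  | pos n T hT => exact ⟨hT, fun _ _ => trivial⟩

end ApproxVar

/-- The conditions on approximations `y b ∈ A` of the elements `b ∈ B` and `Z T` of the positive
matrices `T` over `B`: `‖y b‖ = ‖b‖`, `y (c • b + b') = c • y b + y b'`, `y (ι a) = a`, and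
`(Z T) j k = y (T j k)`. -/
inductive ApproxCond {A : Type u} [CStarAlgebra A] (S : OperatorSystem A) (B : Type u)
    [CStarAlgebra B] [PartialOrder B] [StarOrderedRing B] : Type u
  | norm (b : B)
  | lin (c : ℂ) (b b' : B)
  | const (a : A) (ha : a ∈ S)
  | entry (n : ℕ) (T : CStarMatrix (Fin n) (Fin n) B) (hT : 0 ≤ T) (j k : Fin n)

namespace ApproxCond

variable {A : Type u} [CStarAlgebra A] {S : OperatorSystem A}
  {B : Type u} [CStarAlgebra B] [PartialOrder B] [StarOrderedRing B]

/-- The sort of the parameter of a condition. Conditions without a parameter get a dummy. -/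
abbrev paramSort : ApproxCond S B → OpSysSort
  | norm _ => nonneg
  | lin _ _ _ => scal 1 1
  | const _ _ => mat 1
  | entry _ _ _ _ _ => nonneg

/-- The parameter of a condition. -/
def param : (c : ApproxCond S B) → c.paramSort.Val A
  | norm _ => ⟨0⟩
  | lin c _ _ => ⟨oneByOne c⟩
  | const a _ => oneByOne a
  | entry _ _ _ _ _ => ⟨0⟩

theorem param_mem_dom [PartialOrder A] [StarOrderedRing A] (c : ApproxCond S B) :
    c.param ∈ Dom S c.paramSort := by
  cases c with
  | norm b => trivial
  | lin c b b' => trivial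
  | const a ha => exact fun _ _ => ha
  | entry n T hT j k => trivial

/-- The elements which a condition involves. -/
def vars (ι : A →⋆ₐ[ℂ] B) : ApproxCond S B → List (ApproxVar B)
  | norm b => [.elt b]
  | lin c b b' => [.elt (c • b + b'), .elt b, .elt b']
  | const a _ => [.elt (ι a)]
  | entry n T hT j k => [.pos n T hT, .elt (T j k)]

variable {D : Type u} [CStarAlgebra D] [PartialOrder D] [StarOrderedRing D]

/-- The extent to which an assignment fails a condition. -/
noncomputable def defect (ι : A →⋆ₐ[ℂ] B) (f : A →⋆ₐ[ℂ] D) (α : ∀ x : ApproxVar B, x.sort.Val D) :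
    ApproxCond S B → ℝ
  | norm b => |‖α (.elt b)‖ - ‖(oneByOne b : CStarMatrix (Fin 1) (Fin 1) B)‖|
  | lin c b b' => ‖α (.elt (c • b + b')) - (c • α (.elt b) + α (.elt b'))‖
  | const a _ => ‖α (.elt (ι a)) - oneByOne (f a)‖
  | entry n T hT j k => ‖oneByOne (α (.pos n T hT) j k) - α (.elt (T j k))‖

theorem defect_val (ι : A →⋆ₐ[ℂ] B) (c : ApproxCond S B) : c.defect ι ι ApproxVar.val = 0 := by
  cases c with
  | norm b => simp [defect, ApproxVar.val]
  | lin c b b' => exact norm_eq_zero.2 (sub_eq_zero.2 rfl)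
  | const a ha => exact norm_eq_zero.2 (sub_eq_zero.2 rfl)
  | entry n T hT j k => exact norm_eq_zero.2 (sub_eq_zero.2 rfl)

/-- The assignment of variables from an assignment of values to the elements `e j`, with the
parameters of the conditions `d i`. -/
def assignment {p q : ℕ} (f : A →⋆ₐ[ℂ] D) (α : ∀ x : ApproxVar B, x.sort.Val D)
    (d : Fin p → ApproxCond S B) (e : Fin q → ApproxVar B) :
    ∀ x, (Sum.elim (fun i => (d i).paramSort) (fun j => (e j).sort) x).Val D
  | .inl i => Val.map f _ (d i).param
  | .inr j => α (e j)

/-- The defect of a condition is given by a quantifier-free formula. -/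
theorem exists_formula (ι : A →⋆ₐ[ℂ] B) {p q : ℕ} (d : Fin p → ApproxCond S B)
    (e : Fin q → ApproxVar B) (i : Fin p) (hvars : ∀ x ∈ (d i).vars ι, ∃ j, e j = x) :
    ∃ φ : OpSysQF (Sum.elim (fun i => (d i).paramSort) (fun j => (e j).sort)),
      ∀ (D : Type u) [CStarAlgebra D] [PartialOrder D] [StarOrderedRing D] (f : A →⋆ₐ[ℂ] D)
        (α : ∀ x : ApproxVar B, x.sort.Val D),
        φ.eval (assignment f α d e) = (d i).defect ι f α := by
  have hvar : ∀ x ∈ (d i).vars ι,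
      ∃ t : OpSysTerm (Sum.elim (fun i => (d i).paramSort) (fun j => (e j).sort)) x.sort,
        ∀ (D : Type u) [CStarAlgebra D] [PartialOrder D] [StarOrderedRing D] (f : A →⋆ₐ[ℂ] D)
          (α : ∀ x : ApproxVar B, x.sort.Val D), t.eval (assignment f α d e) = α x := by
    intro x hx
    obtain ⟨j, rfl⟩ := hvars x hx
    exact ⟨OpSysTerm.var (σ := Sum.elim (fun i => (d i).paramSort) (fun j => (e j).sort))
      (Sum.inr j), fun D _ _ _ f α => rfl⟩
  have hpar : ∃ t : OpSysTerm (Sum.elim (fun i => (d i).paramSort) (fun j => (e j).sort))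
      (d i).paramSort, ∀ (D : Type u) [CStarAlgebra D] [PartialOrder D] [StarOrderedRing D]
        (f : A →⋆ₐ[ℂ] D) (α : ∀ x : ApproxVar B, x.sort.Val D),
        t.eval (assignment f α d e) = Val.map f _ (d i).param :=
    ⟨OpSysTerm.var (σ := Sum.elim (fun i => (d i).paramSort) (fun j => (e j).sort)) (Sum.inl i),
      fun D _ _ _ f α => rfl⟩
  generalize d i = c at hvar hpar ⊢
  cases c with
  | norm b =>
    obtain ⟨t, ht⟩ := hvar (.elt b) (by simp [vars])
    refine ⟨.conn (k := 1) (fun x => |x 0 - ‖(oneByOne b : CStarMatrix (Fin 1) (Fin 1) B)‖|)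
      (by fun_prop) fun _ => .norm t, fun D _ _ _ f α => ?_⟩
    simp only [OpSysQF.eval, ht]
    rfl
  | lin c b b' =>
    obtain ⟨t₁, h₁⟩ := hvar (.elt (c • b + b')) (by simp [vars])
    obtain ⟨t₂, h₂⟩ := hvar (.elt b) (by simp [vars])
    obtain ⟨t₃, h₃⟩ := hvar (.elt b') (by simp [vars])
    obtain ⟨t, ht⟩ := hpar
    refine ⟨.dist t₁ (.add (.smul t t₂) t₃), fun D _ _ _ f α => ?_⟩
    simp only [OpSysQF.eval, OpSysTerm.eval, h₁, h₂, h₃, ht]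
    rfl
  | const a ha =>
    obtain ⟨t₁, h₁⟩ := hvar (.elt (ι a)) (by simp [vars])
    obtain ⟨t, ht⟩ := hpar
    refine ⟨.dist t₁ t, fun D _ _ _ f α => ?_⟩
    simp only [OpSysQF.eval, h₁, ht]
    rfl
  | entry n T hT j k =>
    obtain ⟨t₁, h₁⟩ := hvar (.pos n T hT) (by simp [vars])
    obtain ⟨t₂, h₂⟩ := hvar (.elt (T j k)) (by simp [vars])
    refine ⟨.dist (.entry j k (.incl t₁)) t₂, fun D _ _ _ f α => ?_⟩
    simp only [OpSysQF.eval, OpSysTerm.eval, h₁, h₂]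
    rfl

end ApproxCond

theorem OpSysSort.zero_mem_dom {A : Type u} [CStarAlgebra A] [PartialOrder A] [StarOrderedRing A]
    (S : OperatorSystem A) (s : OpSysSort) : ∃ x ∈ Dom S s, Val.size s x = 0 := by
  have h0 : (0 : A) ∈ S := S.toSubmodule.zero_mem
  cases s with
  | mat n => exact ⟨(0 : CStarMatrix (Fin n) (Fin n) A), fun _ _ => h0, norm_zero⟩
  | cone n => exact ⟨(0 : CStarMatrix (Fin n) (Fin n) A), ⟨le_rfl, fun _ _ => h0⟩, norm_zero⟩
  | scal m n => exact ⟨⟨0⟩, trivial, norm_zero⟩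
  | nonneg => exact ⟨⟨0⟩, trivial, NNReal.coe_zero⟩

theorem OpSysSort.Val.map_id {A : Type u} [CStarAlgebra A] (s : OpSysSort) (x : s.Val A) :
    Val.map (StarAlgHom.id ℂ A) s x = x := by
  cases s <;> rfl

namespace OperatorSystem.IsExistentialEmbedding

variable {A B : Type u} [CStarAlgebra A] [PartialOrder A] [StarOrderedRing A]
  [CStarAlgebra B] [PartialOrder B] [StarOrderedRing B] {ι : A →⋆ₐ[ℂ] B} {S : OperatorSystem A}

theorem exists_defect_lt (h : IsExistentialEmbedding ι S (whole B))
    (C : Finset (ApproxCond S B)) {ε : ℝ} (hε : 0 < ε) :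
    ∃ α : ∀ x : ApproxVar B, x.sort.Val A, (∀ x, α x ∈ Dom S x.sort) ∧
      ∀ c ∈ C, c.defect ι (StarAlgHom.id ℂ A) α < ε := by
  classical
  let F : Finset (ApproxVar B) := C.biUnion fun c => (c.vars ι).toFinset
  let d : Fin C.card → ApproxCond S B := fun i => C.equivFin.symm i
  let e : Fin F.card → ApproxVar B := fun i => F.equivFin.symm i
  have he : Function.Injective e := Subtype.val_injective.comp F.equivFin.symm.injective
  have hd : ∀ c ∈ C, ∃ i, d i = c := fun c hc => ⟨C.equivFin ⟨c, hc⟩, by simp [d]⟩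
  have hdvars : ∀ i, ∀ x ∈ (d i).vars ι, ∃ j, e j = x := fun i x hx => by
    have hxF : x ∈ F := Finset.mem_biUnion.2 ⟨d i, (C.equivFin.symm i).2, by simpa using hx⟩
    exact ⟨F.equivFin ⟨x, hxF⟩, by simp [e]⟩
  choose φ hφ using fun i => ApproxCond.exists_formula ι d e i (hdvars i)
  let ψ : OpSysQF (Sum.elim (fun i => (d i).paramSort) (fun j => (e j).sort)) :=
    .conn (fun x => ∑ i, |x i|) (by fun_prop) φ
  -- The radii of the domains of quantification have to be at least `1`.
  let N : Fin F.card → ℕ := fun j => ⌈Val.size _ (e j).val⌉₊ + 1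
  have hval : ψ.existsValue N (whole B) (fun i => Val.map ι _ (d i).param) = 0 := by
    refine IsLeast.csInf_eq ⟨⟨fun j => (e j).val, fun j => ⟨(e j).val_mem_dom, ?_⟩, ?_⟩, ?_⟩
    · exact (Nat.le_ceil _).trans (by simp [N])
    · have : ψ.eval (ApproxCond.assignment ι ApproxVar.val d e) = 0 := by
        simp only [ψ, OpSysQF.eval, hφ, ApproxCond.defect_val, abs_zero, Finset.sum_const_zero]
      refine this.symm.trans (congrArg (fun a => ψ.eval a) ?_)
      funext x
      rcases x with x | x <;> rfl
    · rintro x ⟨b, hb, rfl⟩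
      exact Finset.sum_nonneg fun _ _ => abs_nonneg _
  rw [← h.2.2 _ _ _ _ ψ N (fun j => by simp [N]) _ fun i => (d i).param_mem_dom] at hval
  choose z hz hz0 using fun s => OpSysSort.zero_mem_dom S s
  have hlt := hval.trans_lt hε
  rw [OpSysQF.existsValue] at hlt
  obtain ⟨_, ⟨b, hb, rfl⟩, hlt⟩ := exists_lt_of_csInf_lt (by
    exact ⟨_, fun j => z (e j).sort, fun j => ⟨hz _, (hz0 _).trans_le (Nat.cast_nonneg _)⟩, rfl⟩)
    hlt
  -- Elements outside `F` occur in no condition of `C`; they are approximated by `0`.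
  have hext : ∀ x : ApproxVar B, ∃ y ∈ Dom S x.sort, ∀ j (hj : e j = x), y = hj ▸ b j := by
    intro x
    by_cases hx : ∃ j, e j = x
    · obtain ⟨j, rfl⟩ := hx
      refine ⟨b j, (hb j).1, fun k hk => ?_⟩
      obtain rfl := he hk
      rfl
    · exact ⟨z _, hz _, fun j hj => absurd ⟨j, hj⟩ hx⟩
  choose α hα hαb using hext
  refine ⟨α, hα, fun c hc => ?_⟩
  obtain ⟨i, rfl⟩ := hd c hc
  rw [← hφ i A (StarAlgHom.id ℂ A) α]
  have hlt' : ψ.eval (ApproxCond.assignment (StarAlgHom.id ℂ A) α d e) < ε := by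
    refine lt_of_eq_of_lt (congrArg (fun a => ψ.eval a) ?_) hlt
    funext x
    rcases x with x | x
    · exact Val.map_id _ _
    · exact hαb (e x) x rfl
  have hsum := Finset.single_le_sum
    (f := fun i => |(φ i).eval (ApproxCond.assignment (StarAlgHom.id ℂ A) α d e)|)
    (fun _ _ => abs_nonneg _) (Finset.mem_univ i)
  exact ((le_abs_self _).trans hsum).trans_lt hlt'

/-- If `S` is existentially closed in `B`, then there are approximate maps from `B` to `S`, indexed
by a directed family: they are asymptotically contractive, linear and the identity on `S`, and their
amplifications to matrices are asymptotically positive. -/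
theorem exists_approx_maps (h : IsExistentialEmbedding ι S (whole B)) :
    ∃ (I : Type u) (l : Filter I) (y : I → B → A)
      (Z : I → ∀ n, CStarMatrix (Fin n) (Fin n) B → CStarMatrix (Fin n) (Fin n) A), l.NeBot ∧
      (∀ i b, y i b ∈ S) ∧
      (∀ b, ∀ ε > 0, ∀ᶠ i in l, ‖y i b‖ ≤ ‖b‖ + ε) ∧
      (∀ (c : ℂ) b b', Tendsto (fun i => y i (c • b + b') - (c • y i b + y i b')) l (𝓝 0)) ∧
      (∀ a ∈ S, Tendsto (fun i => y i (ι a)) l (𝓝 a)) ∧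
      (∀ i n T, 0 ≤ Z i n T) ∧
      (∀ n T, 0 ≤ T → ∀ j k, Tendsto (fun i => Z i n T j k - y i (T j k)) l (𝓝 0)) := by
  classical
  choose α hα hlt using fun i : Finset (ApproxCond S B) × ℕ =>
    h.exists_defect_lt i.1 (ε := 1 / ((i.2 : ℝ) + 1)) (by positivity)
  have hev : ∀ c : ApproxCond S B, ∀ ε > 0, ∀ᶠ i in atTop,
      c.defect ι (StarAlgHom.id ℂ A) (α i) < ε := by
    intro c ε hε
    obtain ⟨n, hn⟩ := exists_nat_one_div_lt hε
    filter_upwards [eventually_ge_atTop (({c}, n) : Finset (ApproxCond S B) × ℕ)] with i hi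
    refine (hlt i c (hi.1 (Finset.mem_singleton_self c))).trans (lt_of_le_of_lt ?_ hn)
    exact one_div_le_one_div_of_le (by positivity)
      (by have : (n : ℝ) ≤ i.2 := by exact_mod_cast hi.2
          linarith)
  have hentry : ∀ {M : Finset (ApproxCond S B) × ℕ → CStarMatrix (Fin 1) (Fin 1) A},
      (∀ ε > 0, ∀ᶠ i in atTop, ‖M i‖ < ε) → Tendsto (fun i => M i 0 0) atTop (𝓝 0) := by
    intro M hM
    refine Metric.tendsto_nhds.2 fun ε hε => (hM ε hε).mono fun i hi => ?_
    rw [dist_zero_right]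
    exact CStarMatrix.norm_entry_le_norm.trans_lt hi
  refine ⟨Finset (ApproxCond S B) × ℕ, atTop, fun i b => α i (.elt b) 0 0,
    fun i n T => if hT : 0 ≤ T then α i (.pos n T hT) else 0, inferInstance,
    fun i b => hα i (.elt b) 0 0, fun b ε hε => ?_, fun c b b' => ?_, fun a ha => ?_,
    fun i n T => ?_, fun n T hT j k => ?_⟩
  · filter_upwards [hev (.norm b) ε hε] with i hi
    have h1 : ‖(oneByOne b : CStarMatrix (Fin 1) (Fin 1) B)‖ ≤ ‖b‖ :=
      (CStarMatrix.norm_le_sum_norm_entry _).trans (by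
        simp only [Finset.univ_unique, Finset.sum_singleton]
        exact le_rfl)
    have h2 : ‖α i (.elt b) 0 0‖ ≤ ‖α i (.elt b)‖ := CStarMatrix.norm_entry_le_norm
    have h3 := (abs_lt.1 hi).2
    linarith
  · exact hentry (hev (.lin c b b'))
  · exact tendsto_sub_nhds_zero_iff.1 (hentry (hev (.const a ha)))
  · by_cases hT : 0 ≤ T
    · simp only [dif_pos hT]
      exact (hα i (.pos n T hT)).1
    · simp only [dif_neg hT, le_refl]
  · simp only [dif_pos hT]
    exact hentry (hev (.entry n T hT j k))

end OperatorSystem.IsExistentialEmbedding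

/-! ### Limits in the bidual -/

namespace OperatorSystem.IsExistentialEmbedding

variable {A B : Type u} [CStarAlgebra A] [PartialOrder A] [StarOrderedRing A]
  [CStarAlgebra B] [PartialOrder B] [StarOrderedRing B] {ι : A →⋆ₐ[ℂ] B} {S : OperatorSystem A}

/-- If `S ⊆ A` is existentially closed in `B`, then approximate maps from `B` to `S` converge, in
the weak-⋆ topology of the bidual of `A`, to a linear contraction which extends the embedding of
`S`. -/
theorem exists_limit (h : IsExistentialEmbedding ι S (whole B)) :
    ∃ (I : Type u) (U : Ultrafilter I) (y : I → B → A)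
      (Z : I → ∀ n, CStarMatrix (Fin n) (Fin n) B → CStarMatrix (Fin n) (Fin n) A)
      (Λ : B →ₗ[ℂ] StrongDual ℂ (StrongDual ℂ A)),
      (∀ b, ‖Λ b‖ ≤ ‖b‖) ∧
      (∀ a ∈ S, Λ (ι a) = NormedSpace.inclusionInDoubleDual ℂ A a) ∧
      (∀ b f, Tendsto (fun i => f (y i b)) U (𝓝 (Λ b f))) ∧
      (∀ i b, y i b ∈ S) ∧
      (∀ i n T, 0 ≤ Z i n T) ∧
      (∀ n T, 0 ≤ T → ∀ j k, Tendsto (fun i => Z i n T j k - y i (T j k)) U (𝓝 0)) := by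
  obtain ⟨I, l, y, Z, hl, hyS, hynorm, hylin, hyι, hZ, hZy⟩ := h.exists_approx_maps
  let U := Ultrafilter.of l
  have hU : (U : Filter I) ≤ l := Ultrafilter.of_le l
  have hbound : ∀ b (f : StrongDual ℂ A), ∀ ε > 0, ∀ᶠ i in U, ‖f (y i b)‖ ≤ (‖b‖ + ε) * ‖f‖ := by
    intro b f ε hε
    filter_upwards [hU (hynorm b ε hε)] with i hi
    rw [mul_comm]
    exact (f.le_opNorm _).trans (mul_le_mul_of_nonneg_left hi (norm_nonneg f))
  have hlim : ∀ b (f : StrongDual ℂ A), ∃ z, Tendsto (fun i => f (y i b)) U (𝓝 z) := by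
    intro b f
    obtain ⟨z, -, hz⟩ := (isCompact_closedBall (0 : ℂ) ((‖b‖ + 1) * ‖f‖)).ultrafilter_le_nhds'
      (U.map fun i => f (y i b))
      ((hbound b f 1 one_pos).mono fun i hi => mem_closedBall_zero_iff.2 hi)
    exact ⟨z, hz⟩
  choose L hL using hlim
  have hLnorm : ∀ b f, ‖L b f‖ ≤ ‖b‖ * ‖f‖ := by
    intro b f
    have h1 : Tendsto (fun ε : ℝ => (‖b‖ + ε) * ‖f‖) (𝓝[>] 0) (𝓝 ((‖b‖ + 0) * ‖f‖)) :=
      ((continuous_const.add continuous_id).mul continuous_const).tendsto' 0 _ rfl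
        |>.mono_left nhdsWithin_le_nhds
    rw [add_zero] at h1
    refine ge_of_tendsto h1 ?_
    filter_upwards [self_mem_nhdsWithin] with ε hε
    exact le_of_tendsto (hL b f).norm (hbound b f ε hε)
  let Λ₀ : B → StrongDual ℂ (StrongDual ℂ A) := fun b => LinearMap.mkContinuous
    { toFun := L b
      map_add' := fun f g => tendsto_nhds_unique (hL b (f + g)) ((hL b f).add (hL b g))
      map_smul' := fun c f => tendsto_nhds_unique (hL b (c • f)) ((hL b f).const_smul c) }
    ‖b‖ (hLnorm b)
  have hlin : ∀ (c : ℂ) b b', Λ₀ (c • b + b') = c • Λ₀ b + Λ₀ b' := by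
    intro c b b'
    ext f
    have h1 : Tendsto (fun i => f (y i (c • b + b') - (c • y i b + y i b'))) U (𝓝 (f 0)) :=
      (f.continuous.tendsto 0).comp ((hylin c b b').mono_left hU)
    have h2 := h1.add (((hL b f).const_smul c).add (hL b' f))
    simp only [map_sub, map_add, map_smul, sub_add_cancel, map_zero, zero_add] at h2
    exact tendsto_nhds_unique (hL (c • b + b') f) h2
  have hzero : Λ₀ 0 = 0 := by
    ext f
    exact norm_le_zero_iff.1 ((hLnorm 0 f).trans_eq (by rw [norm_zero, zero_mul]))
  let Λ : B →ₗ[ℂ] StrongDual ℂ (StrongDual ℂ A) :=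
    { toFun := Λ₀
      map_add' := fun b b' => by simpa using hlin 1 b b'
      map_smul' := fun c b => by simpa [hzero] using hlin c b 0 }
  refine ⟨I, U, y, Z, Λ, fun b => LinearMap.mkContinuous_norm_le _ (norm_nonneg b) (hLnorm b),
    fun a ha => ?_, hL, hyS, hZ, fun n T hT j k => (hZy n T hT j k).mono_left hU⟩
  ext f
  exact tendsto_nhds_unique (hL (ι a) f)
    ((f.continuous.tendsto a).comp ((hyι a ha).mono_left hU))

end OperatorSystem.IsExistentialEmbedding

theorem IsSemiExistentiallyClosed.hasWeakExpectationProperty {A : Type u} [CStarAlgebra A]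
    [PartialOrder A] [StarOrderedRing A] (hA : IsSemiExistentiallyClosed A) :
    HasWeakExpectationProperty A := by
  intro B _ ι hι
  let : PartialOrder B := CStarAlgebra.spectralOrder B
  have : StarOrderedRing B := CStarAlgebra.spectralOrderedRing B
  obtain ⟨I, U, y, Z, Λ, hΛ, hΛι, -⟩ := (hA B ι hι).exists_limit
  exact ⟨Λ, hΛ, fun a => hΛι a trivial⟩

/-! ### Vector functionals and positive matrices of operators -/

section Hilbert

open scoped InnerProductSpace

variable {H : Type v} [NormedAddCommGroup H] [InnerProductSpace ℂ H]

/-- The vector functional `T ↦ ⟪x, T y⟫` on `B(H)`. -/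
noncomputable def vectorFunctional (x y : H) : StrongDual ℂ (H →L[ℂ] H) :=
  innerSL ℂ x ∘L ContinuousLinearMap.apply ℂ H y

theorem vectorFunctional_apply (x y : H) (T : H →L[ℂ] H) :
    vectorFunctional x y T = ⟪x, T y⟫_ℂ := rfl

theorem norm_vectorFunctional_le (x y : H) : ‖vectorFunctional x y‖ ≤ ‖x‖ * ‖y‖ := by
  refine ContinuousLinearMap.opNorm_le_bound _ (by positivity) fun T => ?_
  rw [vectorFunctional_apply]
  calc ‖⟪x, T y⟫_ℂ‖ ≤ ‖x‖ * ‖T y‖ := norm_inner_le_norm _ _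
    _ ≤ ‖x‖ * (‖T‖ * ‖y‖) := by gcongr; exact T.le_opNorm y
    _ = _ := by ring

/-- A matrix of operators on `H` as a linear map on `Hⁿ`. -/
noncomputable def CStarMatrix.toEnd {n : ℕ} (M : CStarMatrix (Fin n) (Fin n) (H →L[ℂ] H)) :
    PiLp 2 (fun _ : Fin n => H) →ₗ[ℂ] PiLp 2 (fun _ : Fin n => H) where
  toFun ξ := WithLp.toLp 2 fun j => ∑ k, M j k (ξ k)
  map_add' ξ η := by
    ext j
    simp [Finset.sum_add_distrib]
  map_smul' c ξ := by
    ext j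
    simp [Finset.smul_sum]

namespace CStarMatrix

variable {n : ℕ} (M N : CStarMatrix (Fin n) (Fin n) (H →L[ℂ] H))

theorem toEnd_apply (ξ : PiLp 2 (fun _ : Fin n => H)) (j : Fin n) :
    M.toEnd ξ j = ∑ k, M j k (ξ k) := rfl

theorem inner_toEnd (ξ η : PiLp 2 (fun _ : Fin n => H)) :
    ⟪ξ, M.toEnd η⟫_ℂ = ∑ j, ∑ k, ⟪ξ j, M j k (η k)⟫_ℂ := by
  simp only [PiLp.inner_apply, toEnd_apply, inner_sum]

theorem toEnd_mul (ξ : PiLp 2 (fun _ : Fin n => H)) : (M * N).toEnd ξ = M.toEnd (N.toEnd ξ) := by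
  ext j
  simp only [toEnd_apply, mul_apply, _root_.sum_apply, map_sum]
  rw [Finset.sum_comm]
  rfl

theorem toEnd_injective {M N : CStarMatrix (Fin n) (Fin n) (H →L[ℂ] H)} (h : M.toEnd = N.toEnd) :
    M = N := by
  ext j k x
  have h1 := congrArg (fun L => L (WithLp.toLp 2 (Pi.single k x)) j) h
  have h2 : ∀ P : CStarMatrix (Fin n) (Fin n) (H →L[ℂ] H),
      P.toEnd (WithLp.toLp 2 (Pi.single k x)) j = P j k x := by
    intro P
    rw [toEnd_apply, Finset.sum_eq_single k]
    · simp
    · intro i _ hi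
      simp [Pi.single_eq_of_ne hi]
    · simp
  simpa only [h2] using h1

variable [CompleteSpace H]

theorem inner_toEnd_star (ξ η : PiLp 2 (fun _ : Fin n => H)) :
    ⟪ξ, (star M).toEnd η⟫_ℂ = ⟪M.toEnd ξ, η⟫_ℂ := by
  simp only [PiLp.inner_apply, toEnd_apply, inner_sum, sum_inner, star_apply,
    ContinuousLinearMap.star_eq_adjoint, ContinuousLinearMap.adjoint_inner_right]
  rw [Finset.sum_comm]

variable {M}

theorem inner_toEnd_nonneg (hM : 0 ≤ M) (ξ : PiLp 2 (fun _ : Fin n => H)) :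
    0 ≤ ⟪ξ, M.toEnd ξ⟫_ℂ := by
  obtain ⟨Z, rfl⟩ := exists_star_mul_self_eq_of_nonneg hM
  rw [toEnd_mul, inner_toEnd_star]
  rw [inner_self_eq_norm_sq_to_K, ← RCLike.ofReal_pow]
  exact Complex.zero_le_real.2 (sq_nonneg _)

end CStarMatrix

/-- A self-adjoint element `a` is positive unless some `b ≥ 0` has `b * a * b` negative and nonzero:
if `b` is the negative part of `a`, then `b * a * b = -b ^ 3`. -/
theorem CStarAlgebra.nonneg_of_negPart {D : Type*} [CStarAlgebra D] [PartialOrder D]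
    [StarOrderedRing D] {a : D} (ha : IsSelfAdjoint a)
    (h : ∀ b : D, 0 ≤ b → 0 ≤ -(b * a * b) → b * a * b = 0) : 0 ≤ a := by
  have hb : 0 ≤ a⁻ := CFC.negPart_nonneg a
  have hbs : IsSelfAdjoint a⁻ := hb.isSelfAdjoint
  have h1 : a⁻ * a * a⁻ = -(a⁻ * a⁻ * a⁻) := by
    calc a⁻ * a * a⁻ = a⁻ * (a⁺ - a⁻) * a⁻ := by rw [CFC.posPart_sub_negPart a ha]
      _ = _ := by rw [mul_sub, sub_mul, CFC.negPart_mul_posPart, zero_mul, zero_sub]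
  have h2 : 0 ≤ a⁻ * a⁻ * a⁻ := by
    have := star_left_conjugate_nonneg hb a⁻
    rwa [hbs.star_eq] at this
  have h3 := h _ hb (by rwa [h1, neg_neg])
  rw [h1, neg_eq_zero] at h3
  have h4 : a⁻ * a⁻ = 0 := by
    refine (CStarRing.star_mul_self_eq_zero_iff _).1 ?_
    rw [star_mul, hbs.star_eq, ← mul_assoc, h3, zero_mul]
  have h5 : a⁻ = 0 := by
    refine (CStarRing.star_mul_self_eq_zero_iff _).1 ?_
    rw [hbs.star_eq, h4]
  exact (CFC.negPart_eq_zero_iff a ha).1 h5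

variable [CompleteSpace H]

/-- A matrix of operators on `H` is positive if its quadratic form on `Hⁿ` is. -/
theorem CStarMatrix.nonneg_of_inner_toEnd_nonneg {n : ℕ}
    {M : CStarMatrix (Fin n) (Fin n) (H →L[ℂ] H)}
    (h : ∀ ξ : PiLp 2 (fun _ : Fin n => H), 0 ≤ ⟪ξ, M.toEnd ξ⟫_ℂ) : 0 ≤ M := by
  -- Quadratic forms determine matrices, by polarization over `ℂ`.
  have hext : ∀ {P Q : CStarMatrix (Fin n) (Fin n) (H →L[ℂ] H)},
      (∀ ξ, ⟪ξ, P.toEnd ξ⟫_ℂ = ⟪ξ, Q.toEnd ξ⟫_ℂ) → P = Q := by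
    intro P Q hPQ
    refine toEnd_injective (ext_inner_map _ _ |>.1 fun ξ => ?_)
    rw [← inner_conj_symm, hPQ, inner_conj_symm]
  have hsa : IsSelfAdjoint M := by
    refine hext fun ξ => ?_
    rw [inner_toEnd_star, ← inner_conj_symm]
    exact Complex.conj_eq_iff_im.2 (Complex.nonneg_iff.1 (h ξ)).2.symm
  have hconj : ∀ {N : CStarMatrix (Fin n) (Fin n) (H →L[ℂ] H)}, IsSelfAdjoint N →
      ∀ ξ, 0 ≤ ⟪ξ, (N * M * N).toEnd ξ⟫_ℂ := by
    intro N hN ξ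
    nth_rw 1 [← hN.star_eq]
    rw [toEnd_mul, toEnd_mul, inner_toEnd_star]
    exact h _
  refine CStarAlgebra.nonneg_of_negPart (D := CStarMatrix (Fin n) (Fin n) (H →L[ℂ] H)) hsa
    fun N hN hneg => hext fun ξ => ?_
  have h1 := hconj hN.isSelfAdjoint ξ
  have h2 := inner_toEnd_nonneg hneg ξ
  have h3 : ⟪ξ, (-(N * M * N)).toEnd ξ⟫_ℂ = -⟪ξ, (N * M * N).toEnd ξ⟫_ℂ := by
    simp only [inner_toEnd, neg_apply, _root_.neg_apply, inner_neg_right,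
      Finset.sum_neg_distrib]
  have h4 : ⟪ξ, (0 : CStarMatrix (Fin n) (Fin n) (H →L[ℂ] H)).toEnd ξ⟫_ℂ = 0 := by
    simp [inner_toEnd]
  rw [h3] at h2
  rw [h4]
  exact le_antisymm (neg_nonneg.1 h2) h1

/-! ### Weak injectivity -/

/-- Elements of the bidual of `B(H)` restrict to operators on `H`, since `B(H)` is the dual of the
closed span of the vector functionals. -/
theorem exists_operator_of_bidual (ξ : StrongDual ℂ (StrongDual ℂ (H →L[ℂ] H))) :
    ∃ T : H →L[ℂ] H, ∀ x y, ⟪x, T y⟫_ℂ = ξ (vectorFunctional x y) := by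
  let b : H →ₗ⋆[ℂ] H →ₗ[ℂ] ℂ := LinearMap.mk₂'ₛₗ (starRingEnd ℂ) (RingHom.id ℂ)
    (fun x y => ξ (vectorFunctional x y))
    (fun x x' y => by
      rw [← map_add]; congr 1; ext T; exact inner_add_left _ _ _)
    (fun c x y => by
      rw [← map_smul]; congr 1; ext T; exact inner_smul_left _ _ _)
    (fun x y y' => by
      rw [← map_add]; congr 1; ext T
      simp [vectorFunctional_apply])
    (fun c x y => by
      rw [RingHom.id_apply, ← map_smul]; congr 1; ext T
      simp [vectorFunctional_apply])
  refine ⟨ContinuousLinearMap.adjoint (InnerProductSpace.continuousLinearMapOfBilin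
    (b.mkContinuous₂ ‖ξ‖ fun x y => ?_)), fun x y => ?_⟩
  · rw [mul_assoc]
    exact (ξ.le_opNorm _).trans
      (mul_le_mul_of_nonneg_left (norm_vectorFunctional_le x y) (norm_nonneg ξ))
  · rw [ContinuousLinearMap.adjoint_inner_right,
      InnerProductSpace.continuousLinearMapOfBilin_apply]
    rfl

theorem OperatorSystem.IsExistentiallyClosedIn.isWeaklyInjective {X : OperatorSystem (H →L[ℂ] H)}
    (h : X.IsExistentiallyClosedIn (OperatorSystem.whole (H →L[ℂ] H))) : X.IsWeaklyInjective := by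
  obtain ⟨I, U, y, Z, Λ, -, hΛX, hlim, hyX, hZ, hZy⟩ :=
    OperatorSystem.IsExistentialEmbedding.exists_limit h
  choose R hR using fun T => exists_operator_of_bidual (Λ T)
  have hRlim : ∀ T x x', Tendsto (fun i => ⟪x, y i T x'⟫_ℂ) U (𝓝 ⟪x, R T x'⟫_ℂ) := by
    intro T x x'
    rw [hR]
    exact hlim T (vectorFunctional x x')
  have hRX : ∀ T ∈ X, R T = T := by
    intro T hT
    refine ContinuousLinearMap.ext fun x' => ext_inner_left ℂ fun x => ?_
    rw [hR]
    exact congrArg (fun ξ => ξ (vectorFunctional x x')) (hΛX T hT)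
  let φ : (H →L[ℂ] H) →ₗ[ℂ] (H →L[ℂ] H) :=
    { toFun := R
      map_add' := fun S T => by
        refine ContinuousLinearMap.ext fun x' => ext_inner_left ℂ fun x => ?_
        rw [_root_.add_apply, inner_add_right, hR, hR, hR, map_add]
        rfl
      map_smul' := fun c T => by
        refine ContinuousLinearMap.ext fun x' => ext_inner_left ℂ fun x => ?_
        rw [RingHom.id_apply, _root_.smul_apply, inner_smul_right, hR, hR, map_smul]
        rfl }
  refine ⟨⟨φ, fun n M hM => CStarMatrix.nonneg_of_inner_toEnd_nonneg fun ξ => ?_⟩,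
    hRX 1 X.one_mem', fun T => ?_, hRX⟩
  · have h1 : Tendsto (fun i => ⟪ξ, (Z i n M).toEnd ξ⟫_ℂ) U (𝓝 ⟪ξ, (M.map φ).toEnd ξ⟫_ℂ) := by
      simp only [CStarMatrix.inner_toEnd]
      refine tendsto_finsetSum _ fun j _ => tendsto_finsetSum _ fun k _ => ?_
      have h2 := ((vectorFunctional (ξ j) (ξ k)).continuous.tendsto 0).comp (hZy n M hM j k)
      rw [map_zero] at h2
      have h3 := h2.add (hRlim (M j k) (ξ j) (ξ k))
      rw [zero_add] at h3
      refine h3.congr fun i => ?_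
      simp [vectorFunctional_apply]
    exact ge_of_tendsto' h1 fun i => CStarMatrix.inner_toEnd_nonneg (hZ i n M) ξ
  · refine mem_closure_of_tendsto (f := fun i => ContinuousLinearMapWOT.ofCLM (y i T))
      (b := (U : Filter I)) ?_ (Eventually.of_forall fun i => ⟨_, hyX i T, rfl⟩)
    exact ContinuousLinearMapWOT.tendsto_iff_forall_inner_apply_tendsto.2 fun x' x => hRlim T x x'

end Hilbert

theorem mainTheorem5 :
    (∀ (H : Type v) [NormedAddCommGroup H] [InnerProductSpace ℂ H] [CompleteSpace H]
      (X : OperatorSystem (H →L[ℂ] H)),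
      X.IsExistentiallyClosedIn (OperatorSystem.whole (H →L[ℂ] H)) → X.IsWeaklyInjective) ∧
    (∀ (A : Type u) [CStarAlgebra A] [PartialOrder A] [StarOrderedRing A],
      IsSemiExistentiallyClosed A → HasWeakExpectationProperty A) ∧
    (∀ (A : Type u) [CStarAlgebra A] [PartialOrder A] [StarOrderedRing A],
      IsExistentiallyClosedCStarAlgebra A →
        IsSemiExistentiallyClosed A ∧ HasWeakExpectationProperty A) :=
  ⟨fun _ _ _ _ _ h => h.isWeaklyInjective, fun _ _ _ _ h => h.hasWeakExpectationProperty,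
    fun _ _ _ _ h => ⟨h.isSemiExistentiallyClosed,
      h.isSemiExistentiallyClosed.hasWeakExpectationProperty⟩⟩
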